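/- Let $k\ge 0$ and $d\ge 1$ be fixed integers and let $\sigma>0$. For $N\ge 1$ put $n=N^d$ and index vectors in $\mathbb{R}^n$ by the points of the lattice $\{1/N,2/N,\ldots,1\}^d$. Let $D_m\in\mathbb{R}^{(m-1)\times m}$ be the first difference matrix, $(D_m v)_i=v_{i+1}-v_i$, let $D_N^{(1)}=D_N$ and $D_N^{(r+1)}=D_{N-r}D_N^{(r)}$, and let $\Delta=\Delta_{n,d}^{(k+1)}$ be the matrix obtained by stacking the $d$ Kronecker products $D_N^{(k+1)}\otimes I_N\otimes\cdots\otimes I_N,\ \ldots,\ I_N\otimes\cdots\otimes I_N\otimes D_N^{(k+1)}$ (each with $d$ factors). Given $y\in\mathbb{R}^n$ and $\lambda\ge 0$, the $k$-th order Kronecker trend filtering (KTF) estimate is $$\hat\theta=\mathop{\mathrm{argmin}}_{\theta\in\mathbb{R}^n}\ \tfrac12\|y-\theta\|_2^2+\lambda\|\Delta\theta\|_1 .$$ Let $\theta_0=\theta_{0,n}\in\mathbb{R}^n$ be a sequence of mean vectors, let $y_i\sim N(\theta_{0,i},\sigma^2)$ independently for $i=1,\ldots,n$, and put $C_n=\|\Delta\theta_0\|_1$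 and $s=(k+1)/d$. All asymptotics are for $N\to\infty$ (so $n=N^d\to\infty$) with $k,d,\sigma$ fixed; $a_n\asymp b_n$ means that $a_n/b_n$ is bounded above and away from zero for all large $n$, and $A_n=O_{\mathbb{P}}(b_n)$ means that $A_n/b_n$ is bounded in probability. Then there is a constant $c_0>0$, depending only on $k,d,\sigma$, with the following property. Assume the canonical scaling $C_n\asymp n^{1-s}$, and let the tuning parameter $\lambda=\lambda_n\ge 0$ satisfy $\lambda_n\asymp a_n$, where $$a_n=\begin{cases}\sqrt{\log n} & \text{if } s<1/2,\\ \log n & \text{if } s=1/2,\\ (\log n)^{\frac1{2s+1}}\,(n/C_n)^{\frac{2s-1}{2s+1}} & \text{if } s>1/2,\end{cases}$$ and, in the case $s\le 1/2$, moreover $\lambda_n\ge c_0a_n$ for all large $n$. Then the KTF estimator satisfies $$\frac1n\|\hat\theta-\theta_0\|_2^2=\begin{cases}O_{\mathbb{P}}\big(n^{-s}\sqrt{\log n}\big) & \text{if } s<1/2,\\ O_{\mathbb{P}}\big(n^{-s}\log n\big) & \text{if } s=1/2,\\ O_{\mathbb{P}}\big(n^{-\frac{2s}{2s+1}}(\log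 n)^{\frac1{2s+1}}\big) & \text{if } s>1/2.\end{cases}$$ -/

import Mathlib

open MeasureTheory ProbabilityTheory Filter Asymptotics
open scoped NNReal

noncomputable section

/-- Positions in the lattice `{1/N, 2/N, …, 1}^d`: the index tuple `i` stands for the point with
coordinates `(i j + 1) / N`. There are `n = N ^ d` of them. -/
abbrev LatticeIdx (d N : ℕ) : Type := Fin d → Fin N

/-- The first difference matrix `D_m`, of size `(m - 1) × m`, with rows `(0,…,0,-1,1,0,…,0)`. -/
def firstDiffMat (m : ℕ) : Matrix (Fin (m - 1)) (Fin m) ℝ :=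
  Matrix.of fun i j => if (j : ℕ) = (i : ℕ) then -1 else if (j : ℕ) = (i : ℕ) + 1 then 1 else 0

/-- The difference matrix of order `r` on `N` points, of size `(N - r) × N`, defined by
`D_N^(0) = I` and `D_N^(r+1) = D_{N-r} D_N^(r)` (so `D_N^(1) = D_N`). -/
def diffMat (N : ℕ) : (r : ℕ) → Matrix (Fin (N - r)) (Fin N) ℝ
  | 0 => (1 : Matrix (Fin N) (Fin N) ℝ)
  | r + 1 => firstDiffMat (N - r) * diffMat N r

/-- Row labels of the Kronecker trend filtering penalty matrix. The rows of the `j`-th block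
`I ⊗ ⋯ ⊗ D_N^(k+1) ⊗ ⋯ ⊗ I` (difference matrix in slot `j`) are labelled by a row of
`D_N^(k+1)` and one row of `I_N` for each of the other `d - 1` slots. -/
abbrev KTFRow (k d N : ℕ) : Type :=
  Σ j : Fin d, Fin (N - (k + 1)) × ({i : Fin d // i ≠ j} → Fin N)

/-- The Kronecker trend filtering penalty matrix of order `k` on the lattice with side length `N`
in dimension `d`: the `d` Kronecker products `I ⊗ ⋯ ⊗ D_N^(k+1) ⊗ ⋯ ⊗ I`, stacked. The entries
of a Kronecker product are the products of the entries of its factors. -/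
def ktfMat (k d N : ℕ) : Matrix (KTFRow k d N) (LatticeIdx d N) ℝ :=
  Matrix.of fun r x =>
    diffMat N (k + 1) r.2.1 (x r.1) *
      ∏ i : {i : Fin d // i ≠ r.1}, (1 : Matrix (Fin N) (Fin N) ℝ) (r.2.2 i) (x i)

/-- The `k`-th order Kronecker total variation of `θ`: the `ℓ¹` norm of the penalty matrix
applied to `θ`. -/
def ktv (k : ℕ) {d N : ℕ} (θ : LatticeIdx d N → ℝ) : ℝ :=
  ∑ r, |(ktfMat k d N).mulVec θ r|

/-- The Kronecker trend filtering criterion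
`½ ‖y - θ‖₂² + lam * ‖Δ θ‖₁`, with `Δ` the penalty matrix. -/
def ktfCriterion (k : ℕ) {d N : ℕ} (lam : ℝ) (y θ : LatticeIdx d N → ℝ) : ℝ :=
  1 / 2 * ∑ x, (y x - θ x) ^ 2 + lam * ktv k θ

/-- `θhat` is the `k`-th order Kronecker trend filtering estimate for the data `y` and the tuning
parameter `lam`, that is, the minimizer of the criterion (unique for `lam ≥ 0`). -/
def IsKTFEstimate (k : ℕ) {d N : ℕ} (lam : ℝ) (y θhat : LatticeIdx d N → ℝ) : Prop :=
  ∀ θ : LatticeIdx d N → ℝ, ktfCriterion k lam y θhat ≤ ktfCriterion k lam y θ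

/-- The data model: the `y x` are independent, `y x` having the law `N(θ₀ x, σ²)`. -/
structure IsNormalMeansData {ι Ω : Type*} [MeasurableSpace Ω] (P : Measure Ω) (σ : ℝ≥0)
    (θ₀ : ι → ℝ) (y : Ω → ι → ℝ) : Prop where
  indep : iIndepFun (fun x ω => y ω x) P
  law : ∀ x, HasLaw (fun ω => y ω x) (gaussianReal (θ₀ x) (σ ^ 2)) P

/-- `A_N = O_P(b_N)` as `N → ∞`: the ratio `A_N / b_N` is bounded in probability. -/
def IsBigOInProb {Ω : ℕ → Type*} [∀ N, MeasurableSpace (Ω N)] (P : ∀ N, Measure (Ω N))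
    (A : ∀ N, Ω N → ℝ) (b : ℕ → ℝ) : Prop :=
  ∀ ε : ℝ, 0 < ε → ∃ M : ℝ, 0 < M ∧
    ∀ᶠ N in atTop, P N {ω | M * |b N| < |A N ω|} ≤ ENNReal.ofReal ε

/-- The effective smoothness `s = (k + 1) / d`. -/
def effSmooth (k d : ℕ) : ℝ := ((k : ℝ) + 1) / (d : ℝ)

/-- The order of magnitude of the tuning parameter, for effective smoothness `s`, sample size `n`
and Kronecker total variation `C` of the mean. -/
def ktfTuning (s n C : ℝ) : ℝ :=
  if s < 1 / 2 then √(Real.log n)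
  else if s = 1 / 2 then Real.log n
  else Real.log n ^ (1 / (2 * s + 1)) * (n / C) ^ ((2 * s - 1) / (2 * s + 1))

/-- The error rate under the canonical scaling. -/
def ktfRate (s n : ℝ) : ℝ :=
  if s < 1 / 2 then n ^ (-s) * √(Real.log n)
  else if s = 1 / 2 then n ^ (-s) * Real.log n
  else n ^ (-(2 * s / (2 * s + 1))) * Real.log n ^ (1 / (2 * s + 1))

end

/-!
The error of a penalized least squares estimate is controlled by splitting the noise functional
`⟨ε, δ⟩`. If `1 = S + W Δ` with `Δ` the penalty matrix, then
`⟨ε, δ⟩ = ⟨Sᵀ ε, δ⟩ + ⟨Wᵀ ε, Δ δ⟩ ≤ ‖Sᵀ ε‖₂ ‖δ‖₂ + ‖Wᵀ ε‖_∞ ‖Δ δ‖₁`. The first term is of the order of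
the Frobenius norm of `S`; the supremum is at most `√(log n)` times the largest `ℓ²` norm of a column
of `W`, up to constants, by the Gaussian tail and a union bound over the rows of `Δ`. Hence
`‖δ‖₂² ≤ 4 ‖Sᵀ ε‖₂² + 8 λ ‖Δ θ₀‖₁` whenever `λ ≥ ‖Wᵀ ε‖_∞` (`IsKTFEstimate.sum_sq_sub_le`).

The decomposition is built explicitly, without spectral theory. In one dimension, with `E` the unit
shift, `1 - (1 - E ^ t) ^ (k + 1)` predicts a value from `k + 1` values on one side, and
`(1 - E ^ t) ^ (k + 1)` is `(1 + E + ⋯ + E ^ (t - 1)) ^ (k + 1)` applied to differences of order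
`k + 1`. Averaging over `t < L` gives a smoothing matrix `s_L` with entries `O(1 / L)`, bandwidth
`O(L)` and `1 - s_L = w_L D^(k+1)`, where `w_L` has entries `O(L ^ k)`
(`smoothMat_add_remMat_mul`). The window points away from the nearer boundary. In dimension `d`, `S`
is the tensor power of `s_L` with `L = 2 ^ J`, and `1 - S` telescopes over the scales `2 ^ j`, `j < J`,
and over the coordinates; at the scale `2 ^ j` this yields a kernel with entries
`O(2 ^ (j (k + 1 - d)))` supported in boxes of side `O(2 ^ j)`. So `‖S‖_F² = O((N / 2 ^ J) ^ d)`, and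
the squared norms of the columns of `W` are `O(∑_{j < J} 2 ^ (j (2 (k + 1) - d)))`
(`exists_hasMultiscaleDecomposition`). This sum is bounded for `s < 1/2`, equal to `J` for `s = 1/2`,
and of the order `(2 ^ (J d)) ^ (2 s - 1)` for `s > 1/2`. These are the three regimes. For `s ≤ 1/2`
the scale is proportional to `N`; for `s > 1/2` it is the scale at which the two error terms balance
(`inv_ktfRate_rpow_mul_log`).
-/

noncomputable section

/-! ### Polynomial-preserving averages in one dimension -/

open Polynomial in
/-- The polynomial `L⁻¹ ∑_{t < L} (1 - (1 - X ^ t) ^ (k + 1))`. Evaluated at the unit shift `E` it is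
a one-sided averaging operator: each summand predicts a value from those at the distances
`t, 2 t, …, (k + 1) t` on one side and is exact on polynomials of degree at most `k`. -/
def avgPoly (k L : ℕ) : ℝ[X] :=
  C (L : ℝ)⁻¹ * ∑ t ∈ Finset.range L, (1 - (1 - X ^ t) ^ (k + 1))

open Polynomial in
/-- The cofactor of `(1 - X) ^ (k + 1)` in `1 - avgPoly k L`, see `one_sub_avgPoly`. -/
def remPoly (k L : ℕ) : ℝ[X] :=
  C (L : ℝ)⁻¹ * ∑ t ∈ Finset.range L, (∑ i ∈ Finset.range t, X ^ i) ^ (k + 1)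

section Poly
open Polynomial

theorem one_sub_avgPoly (k : ℕ) {L : ℕ} (hL : 1 ≤ L) :
    1 - avgPoly k L = remPoly k L * (1 - X) ^ (k + 1) := by
  have h0 : (L : ℝ) ≠ 0 := by positivity
  have h1 : C (L : ℝ)⁻¹ * (L : ℝ[X]) = 1 := by
    rw [← C_eq_natCast, ← C_mul, inv_mul_cancel₀ h0, C_1]
  have h2 : ∀ t : ℕ, (1 - (X : ℝ[X]) ^ t) ^ (k + 1)
      = (∑ i ∈ Finset.range t, X ^ i) ^ (k + 1) * (1 - X) ^ (k + 1) := fun t => by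
    rw [← mul_neg_geom_sum, mul_pow, mul_comm]
  rw [avgPoly, remPoly, mul_assoc, Finset.sum_mul, ← Finset.sum_congr rfl fun t _ => h2 t,
    Finset.sum_sub_distrib, mul_sub]
  simp [h1]

theorem abs_coeff_geomSum_pow_le (t k a : ℕ) :
    |((∑ i ∈ Finset.range t, (X : ℝ[X]) ^ i) ^ (k + 1)).coeff a| ≤ (t : ℝ) ^ k := by
  induction k generalizing a with
  | zero =>
    simp only [zero_add, pow_one, finsetSum_coeff, coeff_X_pow, pow_zero]
    rw [Finset.sum_ite_eq]
    split_ifs <;> simp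
  | succ k ih =>
    rw [pow_succ, Finset.mul_sum, finsetSum_coeff]
    calc _ ≤ ∑ i ∈ Finset.range t, |(((∑ i ∈ Finset.range t, (X : ℝ[X]) ^ i) ^ (k + 1))
          * X ^ i).coeff a| := Finset.abs_sum_le_sum_abs (fun i => _) _
      _ ≤ ∑ i ∈ Finset.range t, (t : ℝ) ^ k := by
        refine Finset.sum_le_sum fun i _ => ?_
        rw [coeff_mul_X_pow']
        split_ifs
        · exact ih _
        · simp
      _ = (t : ℝ) ^ (k + 1) := by simp [pow_succ']

theorem abs_coeff_remPoly_le (k L a : ℕ) : |(remPoly k L).coeff a| ≤ (L : ℝ) ^ k := by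
  rw [remPoly, coeff_C_mul, finsetSum_coeff, abs_mul, abs_of_nonneg (by positivity)]
  rcases Nat.eq_zero_or_pos L with rfl | hL
  · simp
  rw [inv_mul_le_iff₀ (by positivity)]
  calc _ ≤ ∑ t ∈ Finset.range L,
          |((∑ i ∈ Finset.range t, (X : ℝ[X]) ^ i) ^ (k + 1)).coeff a| :=
        Finset.abs_sum_le_sum_abs _ _
    _ ≤ ∑ t ∈ Finset.range L, (L : ℝ) ^ k := by
        refine Finset.sum_le_sum fun t ht => (abs_coeff_geomSum_pow_le t k a).trans ?_
        have := (Finset.mem_range.1 ht).le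
        gcongr
    _ = (L : ℝ) * (L : ℝ) ^ k := by simp

theorem natDegree_remPoly_le (k L : ℕ) : (remPoly k L).natDegree ≤ (k + 1) * (L - 1) := by
  refine (natDegree_C_mul_le _ _).trans (natDegree_sum_le_of_forall_le _ _ fun t ht => ?_)
  refine natDegree_pow_le.trans (Nat.mul_le_mul_left _ ?_)
  refine natDegree_sum_le_of_forall_le _ _ fun i hi => ?_
  rw [natDegree_X_pow]
  have := Finset.mem_range.1 hi
  have := Finset.mem_range.1 ht
  omega

theorem natDegree_avgPoly_le (k L : ℕ) : (avgPoly k L).natDegree ≤ (k + 1) * (L - 1) := by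
  refine (natDegree_C_mul_le _ _).trans (natDegree_sum_le_of_forall_le _ _ fun t ht => ?_)
  have ht' : t ≤ L - 1 := by have := Finset.mem_range.1 ht; omega
  refine (natDegree_sub_le _ _).trans (max_le (by simp) ?_)
  refine natDegree_pow_le.trans (Nat.mul_le_mul_left _ ?_)
  refine (natDegree_sub_le _ _).trans (max_le (by simp) ?_)
  rwa [natDegree_X_pow]

/-- Averaging over the step `t` spreads the mass: for each `l`, the monomial `X ^ (t * (l + 1))` hits
a given degree for at most one `t`. -/
theorem abs_coeff_avgPoly_le (k L a : ℕ) :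
    |(avgPoly k L).coeff a| ≤ 2 ^ (k + 1) / (L : ℝ) := by
  have h2 : ∀ t : ℕ, (1 - (1 - (X : ℝ[X]) ^ t) ^ (k + 1))
      = ∑ l ∈ Finset.range (k + 1),
        C ((-1) ^ l * ((k + 1).choose (l + 1) : ℝ)) * X ^ (t * (l + 1)) := fun t => by
    rw [sub_eq_neg_add 1 (X ^ t : ℝ[X]), add_pow, Finset.sum_range_succ']
    simp only [one_pow, mul_one, pow_zero, Nat.choose_zero_right, Nat.cast_one,
      sub_add_cancel_right]
    rw [← Finset.sum_neg_distrib]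
    refine Finset.sum_congr rfl fun l _ => ?_
    rw [neg_pow, ← pow_mul, C_mul, C_pow, pow_succ]
    simp only [map_neg, map_one, map_natCast]
    ring
  rw [avgPoly, coeff_C_mul, abs_mul, abs_of_nonneg (by positivity), div_eq_inv_mul]
  refine mul_le_mul_of_nonneg_left ?_ (by positivity)
  simp only [h2]
  rw [Finset.sum_comm, finsetSum_coeff]
  calc _ ≤ ∑ l ∈ Finset.range (k + 1), ((k + 1).choose (l + 1) : ℝ) := by
        refine (Finset.abs_sum_le_sum_abs _ _).trans (Finset.sum_le_sum fun l _ => ?_)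
        rw [← Finset.mul_sum, coeff_C_mul, abs_mul, abs_mul, abs_pow, abs_neg, abs_one, one_pow,
          one_mul, Nat.abs_cast, finsetSum_coeff]
        refine mul_le_of_le_one_right (by positivity) ?_
        simp only [coeff_X_pow]
        rw [Finset.sum_boole, Nat.abs_cast]
        norm_cast
        rw [Finset.card_le_one]
        intro t ht t' ht'
        have h := (Finset.mem_filter.1 ht).2.symm.trans (Finset.mem_filter.1 ht').2
        exact Nat.eq_of_mul_eq_mul_right (Nat.succ_pos l) h
    _ ≤ 2 ^ (k + 1) := by
        have := Nat.sum_range_choose (k + 1)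
        rw [Finset.sum_range_succ'] at this
        have h : ∑ l ∈ Finset.range (k + 1), (k + 1).choose (l + 1) ≤ 2 ^ (k + 1) := by omega
        exact_mod_cast h

theorem avgPoly_one (k : ℕ) : avgPoly k 1 = 1 := by
  simp [avgPoly]

/-- The shift `V ↦ V (· + e)` of real sequences indexed by `ℤ`. -/
def zshift (e : ℤ) : Module.End ℝ (ℤ → ℝ) where
  toFun V z := V (z + e)
  map_add' _ _ := rfl
  map_smul' _ _ := rfl

theorem zshift_pow_apply (e : ℤ) (a : ℕ) (V : ℤ → ℝ) (z : ℤ) :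
    (zshift e ^ a) V z = V (z + e * a) := by
  induction a generalizing z with
  | zero => simp
  | succ a ih =>
    rw [pow_succ', Module.End.mul_apply]
    change (zshift e ^ a) V (z + e) = _
    rw [ih]
    congr 1
    push_cast
    ring

theorem aeval_zshift_apply (e : ℤ) {p : ℝ[X]} {A : ℕ} (hp : p.natDegree < A) (V : ℤ → ℝ) (z : ℤ) :
    aeval (zshift e) p V z = ∑ a ∈ Finset.range A, p.coeff a * V (z + e * a) := by
  rw [aeval_eq_sum_range' hp, LinearMap.sum_apply, Finset.sum_apply]
  refine Finset.sum_congr rfl fun a _ => ?_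
  rw [LinearMap.smul_apply, Pi.smul_apply, zshift_pow_apply, smul_eq_mul]

theorem one_sub_zshift_neg_one_pow (r : ℕ) :
    (1 - zshift (-1)) ^ r = zshift (-1) ^ r * (zshift 1 - 1) ^ r := by
  have h1 : zshift (-1) * zshift 1 = 1 := by
    ext V z
    change V (z + -1 + 1) = V z
    congr 1; ring
  have h2 : zshift 1 * zshift (-1) = 1 := by
    ext V z
    change V (z + 1 + -1) = V z
    congr 1; ring
  have hc : Commute (zshift (-1)) (zshift 1 - 1) := by
    rw [Commute, SemiconjBy, mul_sub, sub_mul, h1, h2]; simp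
  rw [← hc.mul_pow, mul_sub, h1, mul_one]

end Poly

theorem firstDiffMat_mulVec (m : ℕ) (u : Fin m → ℝ) (i : Fin (m - 1)) :
    (firstDiffMat m).mulVec u i = u ⟨i + 1, by omega⟩ - u ⟨i, by omega⟩ := by
  have h : ∀ j : Fin m, firstDiffMat m i j * u j =
      (if j = (⟨i + 1, by omega⟩ : Fin m) then u j else 0)
        - (if j = (⟨i, by omega⟩ : Fin m) then u j else 0) := fun j => by
    simp only [firstDiffMat, Matrix.of_apply, Fin.ext_iff]
    split_ifs <;> first | omega | simp
  simp only [Matrix.mulVec, dotProduct, h, Finset.sum_sub_distrib, Finset.sum_ite_eq',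
    Finset.mem_univ, if_true]

/-- The difference matrix of order `r` is `(E - 1) ^ r`, for any extension `V` of the vector to `ℤ`. -/
theorem diffMat_mulVec {N : ℕ} (r : ℕ) (v : Fin N → ℝ) (V : ℤ → ℝ)
    (hV : ∀ j : Fin N, V (j : ℕ) = v j) (i : Fin (N - r)) :
    (diffMat N r).mulVec v i = ((zshift 1 - 1) ^ r) V (i : ℕ) := by
  induction r with
  | zero => simp [diffMat, hV]
  | succ r ih =>
    rw [diffMat, ← Matrix.mulVec_mulVec, firstDiffMat_mulVec, ih, ih, pow_succ']
    simp [zshift]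

/-- One-dimensional smoothing at scale `L` on `Fin N`: row `x` is `avgPoly k L` evaluated at the shift
pointing away from the nearer end of the interval. For `2 (k + 1) L ≤ N` the window of length
`(k + 1) L` then never leaves the interval, so no boundary correction is needed. -/
def smoothMat (k L N : ℕ) : Matrix (Fin N) (Fin N) ℝ :=
  Matrix.of fun x y =>
    if 2 * (x : ℕ) < N then (if (x : ℕ) ≤ y then (avgPoly k L).coeff (y - x) else 0)
    else (if (y : ℕ) ≤ x then (avgPoly k L).coeff (x - y) else 0)

/-- The kernel through which `1 - smoothMat k L N` factors over the difference matrix of order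
`k + 1`, see `smoothMat_add_remMat_mul`. For left-pointing windows the index is offset by `k + 1`,
because `(1 - E⁻¹) ^ (k + 1) = E ^ (-(k + 1)) (E - 1) ^ (k + 1)`. -/
def remMat (k L N : ℕ) : Matrix (Fin N) (Fin (N - (k + 1))) ℝ :=
  Matrix.of fun x r =>
    if 2 * (x : ℕ) < N then
      (if (x : ℕ) ≤ r then (-1) ^ (k + 1) * (remPoly k L).coeff (r - x) else 0)
    else (if (r : ℕ) + (k + 1) ≤ x then (remPoly k L).coeff (x - (r + (k + 1))) else 0)

/-- At scale `1` only the step `t = 0` occurs, so there is no smoothing. -/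
theorem smoothMat_one (k N : ℕ) : smoothMat k 1 N = 1 := by
  ext x y
  simp only [smoothMat, Matrix.of_apply, avgPoly_one, Polynomial.coeff_one, Matrix.one_apply,
    Fin.ext_iff]
  split_ifs <;> first | omega | rfl

theorem abs_smoothMat_le (k L N : ℕ) (x y : Fin N) :
    |smoothMat k L N x y| ≤ 2 ^ (k + 1) / (L : ℝ) := by
  simp only [smoothMat, Matrix.of_apply]
  split_ifs <;> first | exact abs_coeff_avgPoly_le _ _ _ | (rw [abs_zero]; positivity)

theorem abs_remMat_le (k L N : ℕ) (x : Fin N) (r : Fin (N - (k + 1))) :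
    |remMat k L N x r| ≤ (L : ℝ) ^ k := by
  simp only [remMat, Matrix.of_apply]
  split_ifs
  · rw [abs_mul, abs_pow, abs_neg, abs_one, one_pow, one_mul]
    exact abs_coeff_remPoly_le _ _ _
  · simp
  · exact abs_coeff_remPoly_le _ _ _
  · simp

theorem smoothMat_eq_zero {k L N : ℕ} {x y : Fin N}
    (h : ¬((x : ℕ) ≤ y + (k + 1) * L ∧ (y : ℕ) ≤ x + (k + 1) * L)) :
    smoothMat k L N x y = 0 := by
  have hz : ∀ a, (k + 1) * L < a → (avgPoly k L).coeff a = 0 := fun a ha =>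
    Polynomial.coeff_eq_zero_of_natDegree_lt (((natDegree_avgPoly_le k L).trans
      (Nat.mul_le_mul_left _ (Nat.sub_le _ _))).trans_lt ha)
  simp only [smoothMat, Matrix.of_apply]
  split_ifs <;> first | rfl | (apply hz; omega)

theorem remMat_eq_zero {k L N : ℕ} (hL : 1 ≤ L) {x : Fin N} {r : Fin (N - (k + 1))}
    (h : ¬((x : ℕ) ≤ r + (k + 1) * L ∧ (r : ℕ) ≤ x + (k + 1) * L)) :
    remMat k L N x r = 0 := by
  have hz : ∀ a, (k + 1) * L < a + (k + 1) → (remPoly k L).coeff a = 0 := fun a ha => by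
    refine Polynomial.coeff_eq_zero_of_natDegree_lt ((natDegree_remPoly_le k L).trans_lt ?_)
    rw [Nat.mul_sub]
    have : k + 1 ≤ (k + 1) * L := Nat.le_mul_of_pos_right _ hL
    omega
  simp only [remMat, Matrix.of_apply]
  split_ifs
  · rw [hz _ (by omega), mul_zero]
  · rfl
  · exact hz _ (by omega)
  · rfl

theorem sum_fin_forward {M A b : ℕ} (h : b + A ≤ M) {c : ℕ → ℝ} (hc : ∀ a, A ≤ a → c a = 0)
    (g : ℕ → ℝ) :
    ∑ r : Fin M, (if b ≤ (r : ℕ) then c (r - b) else 0) * g r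
      = ∑ a ∈ Finset.range A, c a * g (b + a) := by
  rw [Fin.sum_univ_eq_sum_range (fun r => (if b ≤ r then c (r - b) else 0) * g r) M]
  symm
  refine Finset.sum_of_injOn (fun a => b + a) (fun _ _ _ _ h => Nat.add_left_cancel h)
    (fun a ha => ?_) (fun r _ hr => ?_) fun a _ => by simp
  · have := Finset.mem_range.1 ha
    exact Finset.mem_coe.2 (Finset.mem_range.2 (by dsimp only; omega))
  · split_ifs with hbr
    · rw [hc, zero_mul]
      by_contra hlt
      exact hr ⟨r - b, by simpa using hlt, by simp only; omega⟩
    · simp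

theorem sum_fin_backward {M A b : ℕ} (h : A ≤ b + 1) (hb : b < M) {c : ℕ → ℝ}
    (hc : ∀ a, A ≤ a → c a = 0) (g : ℕ → ℝ) :
    ∑ r : Fin M, (if (r : ℕ) ≤ b then c (b - r) else 0) * g r
      = ∑ a ∈ Finset.range A, c a * g (b - a) := by
  rw [Fin.sum_univ_eq_sum_range (fun r => (if r ≤ b then c (b - r) else 0) * g r) M]
  symm
  refine Finset.sum_of_injOn (fun a => b - a) (fun a ha a' ha' h => ?_)
    (fun a ha => ?_) (fun r _ hr => ?_) fun a ha => ?_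
  · have := Finset.mem_range.1 ha
    have := Finset.mem_range.1 ha'
    simp only at h
    omega
  · exact Finset.mem_coe.2 (Finset.mem_range.2 (by dsimp only; omega))
  · split_ifs with hbr
    · rw [hc, zero_mul]
      by_contra hlt
      exact hr ⟨b - r, by simpa using hlt, by simp only; omega⟩
    · simp
  · have := Finset.mem_range.1 ha
    rw [if_pos (Nat.sub_le _ _), Nat.sub_sub_self (by omega)]

/-- Smoothing reproduces a vector up to a kernel applied to its differences of order `k + 1`. This is
`one_sub_avgPoly` evaluated at a shift, in the direction chosen row by row. -/
theorem smoothMat_add_remMat_mul {k L N : ℕ} (hL : 1 ≤ L) (hN : 2 * ((k + 1) * L) ≤ N) :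
    smoothMat k L N + remMat k L N * diffMat N (k + 1) = 1 := by
  apply Matrix.ext_of_mulVec_single
  intro j
  generalize (Pi.single j 1 : Fin N → ℝ) = v
  rw [Matrix.add_mulVec, ← Matrix.mulVec_mulVec, Matrix.one_mulVec]
  ext x
  -- the values of `V` outside `{0, …, N - 1}` are never used
  obtain ⟨V, hV⟩ : ∃ V : ℤ → ℝ, ∀ j : Fin N, V (j : ℕ) = v j :=
    ⟨fun z => if h : z.toNat < N then v ⟨z.toNat, h⟩ else 0, fun j => by simp⟩
  -- `A` bounds the number of coefficients of `avgPoly k L` and `remPoly k L`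
  set A := (k + 1) * (L - 1) + 1 with hA
  have hAL : A + k = (k + 1) * L := by
    rw [hA, Nat.mul_sub]
    have : k + 1 ≤ (k + 1) * L := Nat.le_mul_of_pos_right _ hL
    omega
  have hda : (avgPoly k L).natDegree < A := Nat.lt_succ_of_le (natDegree_avgPoly_le k L)
  have hdr : (remPoly k L).natDegree < A := Nat.lt_succ_of_le (natDegree_remPoly_le k L)
  have hza : ∀ a, A ≤ a → (avgPoly k L).coeff a = 0 := fun a ha =>
    Polynomial.coeff_eq_zero_of_natDegree_lt (hda.trans_le ha)
  have hzr : ∀ a, A ≤ a → (remPoly k L).coeff a = 0 := fun a ha =>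
    Polynomial.coeff_eq_zero_of_natDegree_lt (hdr.trans_le ha)
  have hD := diffMat_mulVec (k + 1) v V hV
  have key : ∀ e : ℤ, V (x : ℕ) = Polynomial.aeval (zshift e) (avgPoly k L) V (x : ℕ)
      + Polynomial.aeval (zshift e) (remPoly k L) (((1 - zshift e) ^ (k + 1)) V) (x : ℕ) := by
    intro e
    have h := congrArg (fun p => Polynomial.aeval (zshift e) p V (x : ℕ)) (one_sub_avgPoly k hL)
    simp only [map_sub, map_mul, map_pow, map_one, Polynomial.aeval_X, LinearMap.sub_apply,
      Pi.sub_apply, Module.End.one_apply, Module.End.mul_apply] at h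
    rw [← h]; ring
  have hV' : v = fun j : Fin N => V (j : ℕ) := funext fun j => (hV j).symm
  have hDv : (diffMat N (k + 1)).mulVec v =
      fun r : Fin (N - (k + 1)) => ((zshift 1 - 1) ^ (k + 1)) V (r : ℕ) :=
    funext hD
  rw [Pi.add_apply, hDv, ← hV x, hV']
  simp only [Matrix.mulVec, dotProduct, smoothMat, remMat, Matrix.of_apply]
  by_cases hx : 2 * (x : ℕ) < N
  · simp only [if_pos hx]
    rw [sum_fin_forward (by omega) hza fun j => V j,
      sum_fin_forward (A := A) (c := fun a => (-1) ^ (k + 1) * (remPoly k L).coeff a)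
        (by omega) (fun a ha => by simp [hzr a ha])
        fun r => ((zshift 1 - 1) ^ (k + 1)) V r,
      key 1, aeval_zshift_apply 1 hda, aeval_zshift_apply 1 hdr]
    have hneg : ((1 - zshift 1) ^ (k + 1)) V
        = (-1 : ℝ) ^ (k + 1) • ((zshift 1 - 1) ^ (k + 1)) V := by
      rw [← neg_sub (zshift 1) 1, neg_pow (zshift 1 - 1)]
      rcases Nat.even_or_odd (k + 1) with h' | h' <;> simp [h'.neg_one_pow]
    rw [hneg]
    congr 1 <;> refine Finset.sum_congr rfl fun a _ => ?_
    · push_cast; rw [one_mul]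
    · rw [Pi.smul_apply, smul_eq_mul]
      push_cast
      rw [one_mul]
      ring
  · simp only [if_neg hx]
    have hr : ∀ r : ℕ, (if r + (k + 1) ≤ (x : ℕ) then
        (remPoly k L).coeff (x - (r + (k + 1))) else 0)
        = if r ≤ x - (k + 1) then (remPoly k L).coeff (x - (k + 1) - r) else 0 := fun r => by
      rw [Nat.sub_sub, add_comm r]
      exact if_congr (by omega) rfl rfl
    simp only [hr]
    rw [sum_fin_backward (by omega) x.2 hza fun j => V j,
      sum_fin_backward (by omega) (by omega) hzr fun r => ((zshift 1 - 1) ^ (k + 1)) V r,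
      key (-1), aeval_zshift_apply (-1) hda, aeval_zshift_apply (-1) hdr,
      one_sub_zshift_neg_one_pow]
    congr 1 <;> refine Finset.sum_congr rfl fun a ha => ?_ <;>
      have ha := Finset.mem_range.1 ha
    · rw [Nat.cast_sub (by omega), neg_one_mul, sub_eq_add_neg]
    · rw [Module.End.mul_apply, zshift_pow_apply]
      congr 2
      rw [show ((x - (k + 1) - a : ℕ) : ℤ)
        = (x : ℕ) + -1 * (a : ℤ) + -1 * ((k + 1 : ℕ) : ℤ) by omega]

/-! ### Multiscale decomposition in several dimensions -/

/-- The tensor power `a ⊗ ⋯ ⊗ a`. -/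
def tensorMat (d : ℕ) {N : ℕ} (a : Matrix (Fin N) (Fin N) ℝ) :
    Matrix (LatticeIdx d N) (LatticeIdx d N) ℝ :=
  Matrix.of fun x y => ∏ i, a (x i) (y i)

/-- A left factor of `a ⊗ ⋯ ⊗ a - b ⊗ ⋯ ⊗ b` over the penalty matrix when `a - b` factors as
`w * diffMat N (k + 1)`, see `telescopeMat_mul_ktfMat`. On the rows of the `j`-th block it is
`b ⊗ ⋯ ⊗ b ⊗ w ⊗ a ⊗ ⋯ ⊗ a` with `w` in slot `j`. -/
def telescopeMat (k d : ℕ) {N : ℕ} (a b : Matrix (Fin N) (Fin N) ℝ)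
    (w : Matrix (Fin N) (Fin (N - (k + 1))) ℝ) : Matrix (LatticeIdx d N) (KTFRow k d N) ℝ :=
  Matrix.of fun x r =>
    w (x r.1) r.2.1 * ∏ i : {i : Fin d // i ≠ r.1}, (if i.1 < r.1 then b else a) (x i) (r.2.2 i)

theorem tensorMat_one (d N : ℕ) : tensorMat d (1 : Matrix (Fin N) (Fin N) ℝ) = 1 := by
  ext x y
  simp only [tensorMat, Matrix.of_apply, Matrix.one_apply]
  split_ifs with h
  · simp [h]
  · obtain ⟨i, hi⟩ := Function.ne_iff.1 h
    exact Finset.prod_eq_zero (Finset.mem_univ i) (if_neg hi)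

/-- The factors of the tensor power are exchanged one at a time. -/
theorem telescopeMat_mul_ktfMat {k d N : ℕ} {a b : Matrix (Fin N) (Fin N) ℝ}
    {w : Matrix (Fin N) (Fin (N - (k + 1))) ℝ} (h : a - b = w * diffMat N (k + 1)) :
    telescopeMat k d a b w * ktfMat k d N = tensorMat d a - tensorMat d b := by
  ext x y
  have hb : ∏ i, b (x i) (y i) = ∏ i, (a (x i) (y i) - (a - b) (x i) (y i)) := by simp
  rw [Matrix.sub_apply, tensorMat, tensorMat, Matrix.of_apply, Matrix.of_apply, hb,
    Finset.prod_sub_ordered, sub_sub_cancel, Matrix.mul_apply, Fintype.sum_sigma]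
  refine Finset.sum_congr rfl fun j _ => ?_
  have e1 : ∀ F : Fin d → ℝ, ∏ i : {i : Fin d // i ≠ j}, F i
      = (∏ i with i < j, F i) * ∏ i with j < i, F i := fun F => by
    rw [← Finset.prod_subtype (Finset.univ.filter fun i : Fin d => i ≠ j) (by simp) F,
      ← Finset.prod_filter_mul_prod_filter_not (Finset.univ.filter fun i : Fin d => i ≠ j)
        (fun i => i < j), Finset.filter_filter, Finset.filter_filter]
    congr 1 <;> refine Finset.prod_congr (Finset.filter_congr fun i _ => ?_) fun _ _ => rfl
    · exact ⟨fun h => h.2, fun h => ⟨h.ne, h⟩⟩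
    · exact ⟨fun h => lt_of_le_of_ne (not_lt.1 h.2) (Ne.symm h.1), fun h => ⟨h.ne', h.not_gt⟩⟩
  have e2 : ∑ z : {i : Fin d // i ≠ j} → Fin N,
      ∏ i : {i : Fin d // i ≠ j}, ((if i.1 < j then b else a) (x i) (z i) *
        (1 : Matrix (Fin N) (Fin N) ℝ) (z i) (y i))
      = ∏ i : {i : Fin d // i ≠ j}, (if i.1 < j then b else a) (x i) (y i) := by
    have h' := Finset.prod_univ_sum (fun _ : {i : Fin d // i ≠ j} => (Finset.univ : Finset (Fin N)))
      fun i u => (if i.1 < j then b else a) (x i) u * (1 : Matrix (Fin N) (Fin N) ℝ) u (y i)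
    rw [Fintype.piFinset_univ] at h'
    rw [← h']
    exact Finset.prod_congr rfl fun i _ => by rw [← Matrix.mul_apply, Matrix.mul_one]
  have e3 := e1 fun i => (if i < j then b else a) (x i) (y i)
  have e5 : (a - b) (x j) (y j) = ∑ r, w (x j) r * diffMat N (k + 1) r (y j) := by
    rw [h, Matrix.mul_apply]
  have e4 : (∏ i with i < j, (a (x i) (y i) - (a - b) (x i) (y i))) * ∏ i with j < i, a (x i) (y i)
      = ∏ i : {i : Fin d // i ≠ j}, (if i.1 < j then b else a) (x i) (y i) := by
    rw [e3]
    congr 1 <;> refine Finset.prod_congr rfl fun i hi => ?_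
    · rw [if_pos (Finset.mem_filter.1 hi).2]; simp
    · rw [if_neg (Finset.mem_filter.1 hi).2.not_gt]
  rw [mul_assoc, e4, ← e2, e5, Finset.sum_mul_sum, Fintype.sum_prod_type]
  refine Finset.sum_congr rfl fun r _ => Finset.sum_congr rfl fun z _ => ?_
  simp only [telescopeMat, ktfMat, Matrix.of_apply]
  rw [Finset.prod_mul_distrib]
  ring

/-- The lattice position at which a row of the penalty matrix takes its difference: the smallest
point of its support. -/
def rowBase {k d N : ℕ} (r : KTFRow k d N) (i : Fin d) : ℕ :=
  if h : i = r.1 then r.2.1 else r.2.2 ⟨i, h⟩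

/-- The lattice points within sup-distance `R` of `c`. -/
def latticeBox (d N : ℕ) (c : Fin d → ℕ) (R : ℕ) : Finset (LatticeIdx d N) :=
  Fintype.piFinset fun i => {u : Fin N | (u : ℕ) ≤ c i + R ∧ c i ≤ u + R}

theorem card_filter_near_le (N c R : ℕ) :
    ({u : Fin N | (u : ℕ) ≤ c + R ∧ c ≤ u + R} : Finset (Fin N)).card ≤ 2 * R + 1 := by
  have h : (Finset.Icc (c - R) (c + R)).card ≤ 2 * R + 1 := by rw [Nat.card_Icc]; omega
  refine (Finset.card_le_card_of_injOn (fun u : Fin N => (u : ℕ)) (fun u hu => ?_)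
    Fin.val_injective.injOn).trans h
  have := (Finset.mem_filter.1 hu).2
  exact Finset.mem_coe.2 (Finset.mem_Icc.2 (by dsimp only; omega))

theorem card_latticeBox_le (d N : ℕ) (c : Fin d → ℕ) (R : ℕ) :
    (latticeBox d N c R).card ≤ (2 * R + 1) ^ d := by
  rw [latticeBox, Fintype.card_piFinset]
  calc _ ≤ ∏ _i : Fin d, (2 * R + 1) := Finset.prod_le_prod' fun i _ => card_filter_near_le N (c i) R
    _ = _ := by simp

theorem abs_telescopeMat_le {k d N : ℕ} {a b : Matrix (Fin N) (Fin N) ℝ}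
    {w : Matrix (Fin N) (Fin (N - (k + 1))) ℝ} {α β : ℝ} (ha : ∀ x y, |a x y| ≤ α)
    (hb : ∀ x y, |b x y| ≤ α) (hw : ∀ x r, |w x r| ≤ β) (x : LatticeIdx d N) (r : KTFRow k d N) :
    |telescopeMat k d a b w x r| ≤ β * α ^ (d - 1) := by
  simp only [telescopeMat, Matrix.of_apply]
  rw [abs_mul, Finset.abs_prod]
  refine mul_le_mul (hw _ _) ?_ (by positivity) ((abs_nonneg _).trans (hw (x r.1) r.2.1))
  calc _ ≤ ∏ _i : {i : Fin d // i ≠ r.1}, α := by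
        refine Finset.prod_le_prod (fun _ _ => abs_nonneg _) fun i _ => ?_
        split_ifs
        · exact hb _ _
        · exact ha _ _
    _ = α ^ (d - 1) := by
        rw [Finset.prod_const, Finset.card_univ, Fintype.card_subtype_compl]
        simp

theorem telescopeMat_eq_zero {k d N R : ℕ} {a b : Matrix (Fin N) (Fin N) ℝ}
    {w : Matrix (Fin N) (Fin (N - (k + 1))) ℝ}
    (ha : ∀ x y : Fin N, ¬((x : ℕ) ≤ y + R ∧ (y : ℕ) ≤ x + R) → a x y = 0)
    (hb : ∀ x y : Fin N, ¬((x : ℕ) ≤ y + R ∧ (y : ℕ) ≤ x + R) → b x y = 0)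
    (hw : ∀ (x : Fin N) (r : Fin (N - (k + 1))), ¬((x : ℕ) ≤ r + R ∧ (r : ℕ) ≤ x + R) → w x r = 0)
    {x : LatticeIdx d N} {r : KTFRow k d N} (hx : x ∉ latticeBox d N (rowBase r) R) :
    telescopeMat k d a b w x r = 0 := by
  simp only [latticeBox, Fintype.mem_piFinset, not_forall, Finset.mem_filter, Finset.mem_univ,
    true_and] at hx
  obtain ⟨i, hi⟩ := hx
  simp only [telescopeMat, Matrix.of_apply]
  by_cases h : i = r.1
  · subst h
    rw [hw, zero_mul]
    simpa [rowBase] using hi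
  · rw [Finset.prod_eq_zero (Finset.mem_univ (⟨i, h⟩ : {i : Fin d // i ≠ r.1})), mul_zero]
    rw [rowBase, dif_neg h] at hi
    split_ifs
    · exact hb _ _ hi
    · exact ha _ _ hi

/-- A sum of functions `f j` of sup norm at most `a j` whose supports have size at most `b j`, where
the masses `a j * b j` grow geometrically, has squared `ℓ²` norm of the order of the sum of the
squared norms `a j ^ 2 * b j`. The cross terms are controlled by `|⟨f i, f j⟩| ≤ a j * (a i * b i)`
for `i ≤ j`; the triangle inequality would lose a factor when the norms are all of the same
size. -/
theorem sum_sq_sum_range_le {ι : Type*} [Fintype ι] (f : ℕ → ι → ℝ) (a b : ℕ → ℝ)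
    (B : ℕ → Finset ι) {K : ℝ} (hf : ∀ j x, |f j x| ≤ a j) (hB : ∀ j x, x ∉ B j → f j x = 0)
    (ha : ∀ j, 0 ≤ a j) (hb : ∀ j, ((B j).card : ℝ) ≤ b j)
    (hab : ∀ j, ∑ i ∈ Finset.range (j + 1), a i * b i ≤ K * (a j * b j)) (J : ℕ) :
    ∑ x, (∑ j ∈ Finset.range J, f j x) ^ 2
      ≤ 2 * K * ∑ j ∈ Finset.range J, a j ^ 2 * b j := by
  have h1 : ∀ j, ∑ x, |f j x| ≤ a j * b j := fun j => by
    rw [← Finset.sum_subset (Finset.subset_univ (B j)) fun x _ hx => by rw [hB j x hx, abs_zero]]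
    calc _ ≤ ∑ x ∈ B j, a j := Finset.sum_le_sum fun x _ => hf j x
      _ = (B j).card * a j := by simp
      _ ≤ a j * b j := by rw [mul_comm]; exact mul_le_mul_of_nonneg_left (hb j) (ha j)
  induction J with
  | zero => simp
  | succ J ih =>
    have h2 : ∀ x, (∑ j ∈ Finset.range (J + 1), f j x) ^ 2
        ≤ (∑ j ∈ Finset.range J, f j x) ^ 2
          + 2 * a J * ∑ j ∈ Finset.range (J + 1), |f j x| := fun x => by
      rw [Finset.sum_range_succ, Finset.sum_range_succ]
      have e1 : |∑ j ∈ Finset.range J, f j x| ≤ ∑ j ∈ Finset.range J, |f j x| :=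
        Finset.abs_sum_le_sum_abs _ _
      have e2 : f J x * (∑ j ∈ Finset.range J, f j x)
          ≤ a J * ∑ j ∈ Finset.range J, |f j x| := by
        refine (le_abs_self _).trans ?_
        rw [abs_mul]
        exact mul_le_mul (hf J x) e1 (abs_nonneg _) (ha J)
      have e3 : f J x ^ 2 ≤ a J * |f J x| := by
        rw [← sq_abs, sq]
        exact mul_le_mul_of_nonneg_right (hf J x) (abs_nonneg _)
      nlinarith [mul_nonneg (ha J) (abs_nonneg (f J x))]
    calc _ ≤ ∑ x, ((∑ j ∈ Finset.range J, f j x) ^ 2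
          + 2 * a J * ∑ j ∈ Finset.range (J + 1), |f j x|) := Finset.sum_le_sum fun x _ => h2 x
      _ = ∑ x, (∑ j ∈ Finset.range J, f j x) ^ 2
          + 2 * a J * ∑ j ∈ Finset.range (J + 1), ∑ x, |f j x| := by
        rw [Finset.sum_add_distrib, ← Finset.mul_sum, Finset.sum_comm (s := Finset.univ)]
      _ ≤ 2 * K * ∑ j ∈ Finset.range J, a j ^ 2 * b j + 2 * a J * (K * (a J * b J)) := by
        refine add_le_add ih (mul_le_mul_of_nonneg_left ?_ (by have := ha J; positivity))
        exact (Finset.sum_le_sum fun j _ => h1 j).trans (hab J)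
      _ = _ := by rw [Finset.sum_range_succ]; ring

theorem geom_sum_le_two_mul {q : ℝ} (hq : 2 ≤ q) (j : ℕ) :
    ∑ i ∈ Finset.range (j + 1), q ^ i ≤ 2 * q ^ j := by
  induction j with
  | zero => norm_num
  | succ j ih =>
    rw [Finset.sum_range_succ, pow_succ q j]
    have : 0 ≤ q ^ j := by positivity
    nlinarith

theorem sum_sq_tensorMat_le {d N R : ℕ} {s : Matrix (Fin N) (Fin N) ℝ} {α : ℝ}
    (hs : ∀ x y, |s x y| ≤ α)
    (hz : ∀ x y : Fin N, ¬((x : ℕ) ≤ y + R ∧ (y : ℕ) ≤ x + R) → s x y = 0) :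
    ∑ x, ∑ y, tensorMat d s x y ^ 2 ≤ ((N : ℝ) * ((2 * R + 1) * α ^ 2)) ^ d := by
  have h1 : ∀ u : Fin N, ∑ v, s u v ^ 2 ≤ (2 * R + 1) * α ^ 2 := fun u => by
    have h0 : ∀ v ∈ Finset.univ,
        v ∉ ({v : Fin N | (v : ℕ) ≤ u + R ∧ (u : ℕ) ≤ v + R} : Finset (Fin N)) → s u v ^ 2 = 0 :=
      fun v _ hv => by
        rw [hz u v fun h => hv (by simpa using h.symm)]; simp
    rw [← Finset.sum_subset (Finset.subset_univ _) h0]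
    calc _ ≤ ∑ v ∈ ({v : Fin N | (v : ℕ) ≤ u + R ∧ (u : ℕ) ≤ v + R} : Finset (Fin N)), α ^ 2 :=
          Finset.sum_le_sum fun v _ => sq_le_sq' (neg_le_of_abs_le (hs u v)) (le_of_abs_le (hs u v))
      _ ≤ (2 * R + 1) * α ^ 2 := by
        rw [Finset.sum_const, nsmul_eq_mul]
        refine mul_le_mul_of_nonneg_right ?_ (sq_nonneg _)
        exact_mod_cast card_filter_near_le N u R
  have h2 : ∀ x : LatticeIdx d N, ∑ y, tensorMat d s x y ^ 2 = ∏ i, ∑ v, s (x i) v ^ 2 :=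
    fun x => by
      rw [Finset.prod_univ_sum, Fintype.piFinset_univ]
      simp only [tensorMat, Matrix.of_apply, Finset.prod_pow]
  calc _ ≤ ∑ _x : LatticeIdx d N, ((2 * R + 1) * α ^ 2) ^ d := by
        refine Finset.sum_le_sum fun x _ => ?_
        rw [h2]
        calc _ ≤ ∏ _i : Fin d, ((2 * R + 1) * α ^ 2) :=
              Finset.prod_le_prod (fun _ _ => Finset.sum_nonneg fun _ _ => sq_nonneg _)
                fun i _ => h1 (x i)
          _ = _ := by simp
    _ = _ := by simp [mul_pow]

/-- The factor by which the squared `ℓ²` norm of the columns of the multiscale kernel grows when the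
scale doubles. It is less than, equal to or greater than `1` according to the position of `s`
relative to `1 / 2`. -/
def scaleRatio (k d : ℕ) : ℝ := 2 ^ (2 * (k + 1)) / 2 ^ d

/-- With the constant `K`, and for every scale `2 ^ J` that fits into the lattice, the identity is the
sum of a matrix `S` with small Frobenius norm and a matrix `W * ktfMat k d N` such that the columns
of `W` have small `ℓ²` norm. -/
def HasMultiscaleDecomposition (k d : ℕ) (K : ℝ) : Prop :=
  ∀ N J : ℕ, 2 * ((k + 1) * 2 ^ J) ≤ N →
    ∃ (S : Matrix (LatticeIdx d N) (LatticeIdx d N) ℝ)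
      (W : Matrix (LatticeIdx d N) (KTFRow k d N) ℝ),
      S + W * ktfMat k d N = 1 ∧
      (∀ r, ∑ x, W x r ^ 2 ≤ K * ∑ j ∈ Finset.range J, scaleRatio k d ^ j) ∧
      ∑ x, ∑ y, S x y ^ 2 ≤ K * ((N : ℝ) / 2 ^ J) ^ d

/-- The identity is the tensor power of the smoothing at scale `1`. Passing from the scale `2 ^ j` to
`2 ^ (j + 1)` for `j < J` costs a matrix supported within distance `O(2 ^ j)` with entries
`O(2 ^ (j (k + 1 - d)))`, multiplied by the penalty matrix. -/
theorem exists_hasMultiscaleDecomposition (k d : ℕ) (hd : 1 ≤ d) :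
    ∃ K : ℝ, 0 < K ∧ HasMultiscaleDecomposition k d K := by
  set c₁ : ℝ := 2 ^ (k + 1) * (2 ^ (k + 1)) ^ (d - 1) with hc₁
  set c₂ : ℝ := (5 * (k + 1)) ^ d with hc₂
  refine ⟨max (4 * (c₁ ^ 2 * c₂)) (c₂ * ((2 ^ (k + 1)) ^ 2) ^ d), by positivity, fun N J hJ => ?_⟩
  set s : ℕ → Matrix (Fin N) (Fin N) ℝ := fun j => smoothMat k (2 ^ j) N with hs
  set w : ℕ → Matrix (Fin N) (Fin (N - (k + 1))) ℝ := fun j =>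
    remMat k (2 ^ (j + 1)) N - remMat k (2 ^ j) N with hw
  have hpos : ∀ j : ℕ, 1 ≤ 2 ^ j := fun j => Nat.one_le_two_pow
  have hid : ∀ j ≤ J, s j + remMat k (2 ^ j) N * diffMat N (k + 1) = 1 := fun j hj =>
    smoothMat_add_remMat_mul (hpos j) ((Nat.mul_le_mul_left _ (Nat.mul_le_mul_left _
      (Nat.pow_le_pow_right two_pos hj))).trans hJ)
  have htel : ∀ j < J, telescopeMat k d (s j) (s (j + 1)) (w j) * ktfMat k d N
      = tensorMat d (s j) - tensorMat d (s (j + 1)) := fun j hj => by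
    apply telescopeMat_mul_ktfMat
    rw [hw, Matrix.sub_mul, eq_sub_of_add_eq (hid j hj.le), eq_sub_of_add_eq (hid (j + 1) hj)]
    abel
  refine ⟨tensorMat d (s J),
    ∑ j ∈ Finset.range J, telescopeMat k d (s j) (s (j + 1)) (w j), ?_, fun r => ?_, ?_⟩
  · rw [Matrix.sum_mul, Finset.sum_congr rfl fun j hj => htel j (Finset.mem_range.1 hj),
      Finset.sum_range_sub']
    simp only [hs, pow_zero, smoothMat_one, tensorMat_one]
    abel
  · simp only [Matrix.sum_apply]
    have hα : ∀ j x y, |s j x y| ≤ 2 ^ (k + 1) / 2 ^ j := fun j x y => by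
      simpa using abs_smoothMat_le k (2 ^ j) N x y
    have hα' : ∀ j x y, |s (j + 1) x y| ≤ 2 ^ (k + 1) / 2 ^ j := fun j x y => by
      refine (hα (j + 1) x y).trans ?_
      gcongr <;> norm_num
    have hβ : ∀ j x r, |w j x r| ≤ 2 ^ (k + 1) * (2 ^ j) ^ k := fun j x r => by
      have h1 := abs_remMat_le k (2 ^ (j + 1)) N x r
      have h2 := abs_remMat_le k (2 ^ j) N x r
      push_cast at h1 h2
      have h3 : ((2 : ℝ) ^ j) ^ k ≤ (2 ^ (j + 1)) ^ k := by gcongr <;> norm_num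
      calc |w j x r| ≤ (2 ^ (j + 1)) ^ k + (2 ^ j) ^ k := (abs_sub _ _).trans (add_le_add h1 h2)
        _ ≤ 2 * (2 ^ (j + 1)) ^ k := by linarith
        _ = _ := by rw [pow_succ 2 j, mul_pow]; ring
    have hmul : ∀ j, (k + 1) * 2 ^ j ≤ (k + 1) * 2 ^ (j + 1) := fun j => by gcongr <;> omega
    have hbox := fun j x (hx : x ∉ latticeBox d N (rowBase r) ((k + 1) * 2 ^ (j + 1))) =>
      telescopeMat_eq_zero (a := s j) (b := s (j + 1)) (w := w j)
        (fun x y h => smoothMat_eq_zero fun h' => h (by have := hmul j; omega))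
        (fun x y h => smoothMat_eq_zero h)
        (fun x r h => by
          change (remMat k (2 ^ (j + 1)) N - remMat k (2 ^ j) N) x r = 0
          rw [Matrix.sub_apply, remMat_eq_zero (hpos _) h, remMat_eq_zero (hpos _) fun h' => h
            (by have := hmul j; omega), sub_zero]) hx
    have hcard : ∀ j, ((latticeBox d N (rowBase r) ((k + 1) * 2 ^ (j + 1))).card : ℝ)
        ≤ c₂ * (2 ^ j) ^ d := fun j => by
      have h := card_latticeBox_le d N (rowBase r) ((k + 1) * 2 ^ (j + 1))
      have h' : 2 * ((k + 1) * 2 ^ (j + 1)) + 1 ≤ 5 * (k + 1) * 2 ^ j := by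
        have := hpos j
        rw [pow_succ]
        nlinarith
      rw [hc₂, ← mul_pow]
      exact_mod_cast h.trans (Nat.pow_le_pow_left h' d)
    -- mass and squared norm of the kernel of scale `2 ^ j`
    have hab : ∀ j, 2 ^ (k + 1) * ((2 : ℝ) ^ j) ^ k * (2 ^ (k + 1) / 2 ^ j) ^ (d - 1)
        * (c₂ * (2 ^ j) ^ d) = c₁ * c₂ * (2 ^ (k + 1)) ^ j := fun j => by
      obtain ⟨e, rfl⟩ : ∃ e, d = e + 1 := ⟨d - 1, by omega⟩
      rw [Nat.add_sub_cancel, hc₁, Nat.add_sub_cancel, div_pow, ← pow_mul 2 (k + 1) j,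
        mul_comm (k + 1) j, pow_mul]
      field_simp
      ring
    have haab : ∀ j, (2 ^ (k + 1) * ((2 : ℝ) ^ j) ^ k * (2 ^ (k + 1) / 2 ^ j) ^ (d - 1)) ^ 2
        * (c₂ * (2 ^ j) ^ d) = c₁ ^ 2 * c₂ * scaleRatio k d ^ j := fun j => by
      obtain ⟨e, rfl⟩ : ∃ e, d = e + 1 := ⟨d - 1, by omega⟩
      rw [Nat.add_sub_cancel, hc₁, Nat.add_sub_cancel, div_pow, scaleRatio, div_pow,
        ← pow_mul 2 (2 * (k + 1)) j, ← pow_mul 2 (e + 1) j,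
        mul_comm (2 * (k + 1)) j, mul_comm (e + 1) j, pow_mul 2 j, pow_mul 2 j]
      field_simp
      ring
    have := sum_sq_sum_range_le (K := 2)
      (fun j x => telescopeMat k d (s j) (s (j + 1)) (w j) x r)
      (fun j => 2 ^ (k + 1) * (2 ^ j) ^ k * (2 ^ (k + 1) / 2 ^ j) ^ (d - 1))
      (fun j => c₂ * (2 ^ j) ^ d) _ (fun j x => abs_telescopeMat_le (hα j) (hα' j) (hβ j) x r)
      hbox (fun j => by positivity) hcard (fun j => by
        simp only [hab]
        rw [← Finset.mul_sum]
        have := geom_sum_le_two_mul (q := 2 ^ (k + 1))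
          (le_self_pow₀ (by norm_num) (by omega)) j
        have h0 : 0 ≤ c₁ * c₂ := by positivity
        nlinarith) J
    refine this.trans ?_
    simp only [haab]
    rw [← Finset.mul_sum, ← mul_assoc]
    refine mul_le_mul_of_nonneg_right (le_trans (le_of_eq ?_) (le_max_left _ _))
      (Finset.sum_nonneg fun j _ => by unfold scaleRatio; positivity)
    ring
  · refine (sum_sq_tensorMat_le (α := 2 ^ (k + 1) / 2 ^ J) (R := (k + 1) * 2 ^ J)
      (fun x y => by simpa using abs_smoothMat_le k (2 ^ J) N x y)
      fun x y h => smoothMat_eq_zero h).trans ?_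
    refine le_trans ?_ (mul_le_mul_of_nonneg_right (le_max_right _ _) (by positivity))
    rw [hc₂, ← mul_pow, ← mul_pow]
    have h1 : (1 : ℝ) ≤ 2 ^ J := one_le_pow₀ (by norm_num)
    have h2 : (2 * ((((k + 1) * 2 ^ J : ℕ) : ℝ)) + 1) ≤ 5 * (k + 1) * 2 ^ J := by
      push_cast
      have hk : (0 : ℝ) ≤ k := by positivity
      nlinarith
    refine pow_le_pow_left₀ (by positivity) ?_ d
    calc _ ≤ (N : ℝ) * (5 * (k + 1) * 2 ^ J * (2 ^ (k + 1) / 2 ^ J) ^ 2) := by gcongr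
      _ = _ := by field_simp

/-! ### Gaussian noise -/

section Noise

variable {ι Ω : Type*} [MeasurableSpace Ω] {P : Measure Ω} {σ : ℝ≥0} {θ₀ : ι → ℝ}
  {y : Ω → ι → ℝ}

theorem IsNormalMeansData.hasLaw_mul (h : IsNormalMeansData P σ θ₀ y) (c : ι → ℝ) (x : ι) :
    HasLaw (fun ω => (y ω x - θ₀ x) * c x)
      (gaussianReal 0 (NNReal.mk (c x ^ 2) (sq_nonneg _) * σ ^ 2)) P := by
  have := gaussianReal_mul_const (gaussianReal_sub_const (h.law x) (θ₀ x)) (c x)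
  rwa [sub_self, mul_zero] at this

theorem IsNormalMeansData.iIndepFun_mul (h : IsNormalMeansData P σ θ₀ y) (c : ι → ℝ) :
    iIndepFun (fun x ω => (y ω x - θ₀ x) * c x) P :=
  h.indep.comp (fun x u => (u - θ₀ x) * c x) fun x => by fun_prop

variable [Fintype ι]

theorem IsNormalMeansData.hasSubgaussianMGF_sum (h : IsNormalMeansData P σ θ₀ y) (c : ι → ℝ) :
    HasSubgaussianMGF (fun ω => ∑ x, (y ω x - θ₀ x) * c x)
      (∑ x, NNReal.mk (c x ^ 2) (sq_nonneg _) * σ ^ 2) P := by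
  refine HasSubgaussianMGF.sum_of_iIndepFun (h.iIndepFun_mul c) fun x _ => ⟨fun t => ?_, fun t => ?_⟩
  · have hl := h.hasLaw_mul c x
    have := integrable_exp_mul_gaussianReal (μ := 0) (v := NNReal.mk (c x ^ 2) (sq_nonneg _) * σ ^ 2) t
    rw [← hl.map_eq] at this
    exact this.comp_aemeasurable hl.aemeasurable
  · rw [mgf_gaussianReal (h.hasLaw_mul c x).map_eq, zero_mul, zero_add]

theorem IsNormalMeansData.integral_sum_sq (h : IsNormalMeansData P σ θ₀ y) (c : ι → ℝ) :
    ∫ ω, (∑ x, (y ω x - θ₀ x) * c x) ^ 2 ∂P = σ ^ 2 * ∑ x, c x ^ 2 := by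
  have hP : IsProbabilityMeasure P := h.indep.isProbabilityMeasure
  have hsub := h.hasSubgaussianMGF_sum c
  have hl := h.hasLaw_mul c
  have hmem : ∀ x, MemLp (fun ω => (y ω x - θ₀ x) * c x) 2 P := fun x => by
    have := memLp_id_gaussianReal (μ := 0) (v := NNReal.mk (c x ^ 2) (sq_nonneg _) * σ ^ 2) 2
    rw [← (hl x).map_eq] at this
    exact this.comp_of_map (hl x).aemeasurable
  have hmean : ∫ ω, ∑ x, (y ω x - θ₀ x) * c x ∂P = 0 := by
    rw [integral_finsetSum _ fun x _ => (hmem x).integrable (by norm_num)]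
    exact Finset.sum_eq_zero fun x _ => by rw [(hl x).integral_eq, integral_id_gaussianReal]
  rw [← variance_of_integral_eq_zero hsub.aemeasurable hmean]
  have hvar := IndepFun.variance_sum (s := Finset.univ)
    (X := fun x ω => (y ω x - θ₀ x) * c x) (μ := P) (fun x _ => hmem x)
    fun x _ x' _ hne => (h.iIndepFun_mul c).indepFun hne
  have e : (∑ x, fun ω => (y ω x - θ₀ x) * c x) = fun ω => ∑ x, (y ω x - θ₀ x) * c x := by
    ext ω; simp
  rw [← e, hvar, Finset.mul_sum]
  refine Finset.sum_congr rfl fun x _ => ?_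
  rw [(hl x).variance_eq, variance_id_gaussianReal, mul_comm]
  rfl

theorem IsNormalMeansData.measure_le_abs_sum_le (h : IsNormalMeansData P σ θ₀ y) {c : ι → ℝ}
    {V u : ℝ} (hσ : 0 < σ) (hV : 0 < V) (hc : ∑ x, c x ^ 2 ≤ V) (hu : 0 ≤ u) :
    P.real {ω | u ≤ |∑ x, (y ω x - θ₀ x) * c x|}
      ≤ 2 * Real.exp (-(u ^ 2 / (2 * (σ ^ 2 * V)))) := by
  have hP : IsProbabilityMeasure P := h.indep.isProbabilityMeasure
  have hσ' : (0 : ℝ) < σ := hσ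
  have hsub : HasSubgaussianMGF (fun ω => ∑ x, (y ω x - θ₀ x) * c x)
      (σ ^ 2 * V.toNNReal) P := by
    have h0 := h.hasSubgaussianMGF_sum c
    refine ⟨h0.integrable_exp_mul, fun t => (h0.mgf_le t).trans (Real.exp_le_exp.2 ?_)⟩
    have : ((∑ x, NNReal.mk (c x ^ 2) (sq_nonneg _) * σ ^ 2 : ℝ≥0) : ℝ)
        ≤ ((σ ^ 2 * V.toNNReal : ℝ≥0) : ℝ) := by
      push_cast
      rw [Real.coe_toNNReal _ hV.le, ← Finset.sum_mul, mul_comm]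
      exact mul_le_mul_of_nonneg_left hc (by positivity)
    gcongr
  have hexp : -u ^ 2 / (2 * ((σ ^ 2 * V.toNNReal : ℝ≥0) : ℝ)) = -(u ^ 2 / (2 * (σ ^ 2 * V))) := by
    push_cast
    rw [Real.coe_toNNReal _ hV.le, neg_div]
  have h1 := hsub.measure_ge_le hu
  have h2 := hsub.neg.measure_ge_le hu
  rw [hexp] at h1 h2
  calc P.real {ω | u ≤ |∑ x, (y ω x - θ₀ x) * c x|}
      ≤ P.real ({ω | u ≤ ∑ x, (y ω x - θ₀ x) * c x}
        ∪ {ω | u ≤ (-fun ω => ∑ x, (y ω x - θ₀ x) * c x) ω}) :=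
        measureReal_mono fun ω hω => le_abs.1 (Set.mem_ofPred.1 hω)
    _ ≤ _ := (measureReal_union_le _ _).trans ((add_le_add h1 h2).trans_eq (two_mul _).symm)

theorem IsNormalMeansData.measure_exists_le_abs_sum_le {ρ : Type*} [Fintype ρ]
    (h : IsNormalMeansData P σ θ₀ y) {W : Matrix ι ρ ℝ} {V u : ℝ} (hσ : 0 < σ) (hV : 0 < V)
    (hW : ∀ r, ∑ x, W x r ^ 2 ≤ V) (hu : 0 ≤ u) :
    P {ω | ∃ r, u ≤ |Matrix.vecMul (fun x => y ω x - θ₀ x) W r|}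
      ≤ ENNReal.ofReal (Fintype.card ρ * (2 * Real.exp (-(u ^ 2 / (2 * (σ ^ 2 * V)))))) := by
  have hP : IsProbabilityMeasure P := h.indep.isProbabilityMeasure
  rw [← ofReal_measureReal]
  refine ENNReal.ofReal_le_ofReal ?_
  rw [Set.ofPred_exists]
  calc _ ≤ ∑ r, P.real {ω | u ≤ |Matrix.vecMul (fun x => y ω x - θ₀ x) W r|} :=
        measureReal_iUnion_fintype_le _
    _ ≤ ∑ _r : ρ, 2 * Real.exp (-(u ^ 2 / (2 * (σ ^ 2 * V)))) :=
        Finset.sum_le_sum fun r _ => h.measure_le_abs_sum_le hσ hV (hW r) hu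
    _ = _ := by simp

theorem IsNormalMeansData.measure_le_sum_sq_le {κ : Type*} [Fintype κ]
    (h : IsNormalMeansData P σ θ₀ y) (S : Matrix ι κ ℝ) {V T : ℝ}
    (hS : ∑ x, ∑ z, S x z ^ 2 ≤ V) (hT : 0 < T) :
    P {ω | T ≤ ∑ z, Matrix.vecMul (fun x => y ω x - θ₀ x) S z ^ 2}
      ≤ ENNReal.ofReal (σ ^ 2 * V / T) := by
  have hP : IsProbabilityMeasure P := h.indep.isProbabilityMeasure
  rw [← ofReal_measureReal]
  refine ENNReal.ofReal_le_ofReal ?_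
  have hint : ∀ z, Integrable (fun ω => Matrix.vecMul (fun x => y ω x - θ₀ x) S z ^ 2) P :=
    fun z => ((h.hasSubgaussianMGF_sum fun x => S x z).memLp 2).integrable_sq
  have h1 := mul_meas_ge_le_integral_of_nonneg
    (f := fun ω => ∑ z, Matrix.vecMul (fun x => y ω x - θ₀ x) S z ^ 2) (μ := P)
    (ae_of_all _ fun ω => Finset.sum_nonneg fun z _ => sq_nonneg _)
    (integrable_finsetSum _ fun z _ => hint z) T
  have h2 : ∫ ω, ∑ z, Matrix.vecMul (fun x => y ω x - θ₀ x) S z ^ 2 ∂P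
      = σ ^ 2 * ∑ x, ∑ z, S x z ^ 2 := by
    rw [integral_finsetSum _ fun z _ => hint z, Finset.sum_comm, Finset.mul_sum]
    exact Finset.sum_congr rfl fun z _ => h.integral_sum_sq fun x => S x z
  rw [le_div_iff₀ hT, mul_comm]
  refine h1.trans (h2.le.trans (mul_le_mul_of_nonneg_left hS (by positivity)))

end Noise

/-! ### The basic inequality and the choice of a scale -/

theorem ktv_sub_le (k : ℕ) {d N : ℕ} (θ θ' : LatticeIdx d N → ℝ) :
    ktv k (θ - θ') ≤ ktv k θ + ktv k θ' := by
  rw [ktv, ktv, ktv, ← Finset.sum_add_distrib, Matrix.mulVec_sub]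
  exact Finset.sum_le_sum fun r _ => abs_sub _ _

/-- The basic inequality. The noise enters through `⟨ε, δ⟩ = ⟨Sᵀ ε, δ⟩ + ⟨Wᵀ ε, Δ δ⟩`, where `δ` is the
estimation error; the second term is absorbed by the penalty once `lam` dominates `Wᵀ ε`. -/
theorem IsKTFEstimate.sum_sq_sub_le {k d N : ℕ} {lam : ℝ} {y θ₀ θhat : LatticeIdx d N → ℝ}
    (h : IsKTFEstimate k lam y θhat) (hlam : 0 ≤ lam)
    {S : Matrix (LatticeIdx d N) (LatticeIdx d N) ℝ}
    {W : Matrix (LatticeIdx d N) (KTFRow k d N) ℝ} (hSW : S + W * ktfMat k d N = 1)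
    (hW : ∀ r, |Matrix.vecMul (fun x => y x - θ₀ x) W r| ≤ lam) :
    ∑ x, (θhat x - θ₀ x) ^ 2
      ≤ 4 * ∑ z, Matrix.vecMul (fun x => y x - θ₀ x) S z ^ 2 + 8 * (lam * ktv k θ₀) := by
  set e : LatticeIdx d N → ℝ := fun x => y x - θ₀ x with he
  set δ : LatticeIdx d N → ℝ := θhat - θ₀ with hδ
  have h0 := h θ₀
  have h1 : ∑ x, (y x - θhat x) ^ 2
      = ∑ x, (y x - θ₀ x) ^ 2 - 2 * (e ⬝ᵥ δ) + ∑ x, (θhat x - θ₀ x) ^ 2 := by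
    simp only [dotProduct, Finset.mul_sum, ← Finset.sum_sub_distrib, ← Finset.sum_add_distrib]
    refine Finset.sum_congr rfl fun x _ => ?_
    simp only [he, hδ, Pi.sub_apply]
    ring
  have h2 : e ⬝ᵥ δ = Matrix.vecMul e S ⬝ᵥ δ
      + Matrix.vecMul e W ⬝ᵥ (ktfMat k d N).mulVec δ := by
    conv_lhs => rw [← Matrix.one_mulVec δ, ← hSW, Matrix.add_mulVec, dotProduct_add,
      ← Matrix.mulVec_mulVec, Matrix.dotProduct_mulVec, Matrix.dotProduct_mulVec]
  have h3 : Matrix.vecMul e W ⬝ᵥ (ktfMat k d N).mulVec δ ≤ lam * ktv k δ := by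
    rw [dotProduct, ktv, Finset.mul_sum]
    refine Finset.sum_le_sum fun r _ => (le_abs_self _).trans ?_
    rw [abs_mul]
    exact mul_le_mul_of_nonneg_right (hW r) (abs_nonneg _)
  have h4 : Matrix.vecMul e S ⬝ᵥ δ
      ≤ ∑ z, Matrix.vecMul e S z ^ 2 + 1 / 4 * ∑ x, (θhat x - θ₀ x) ^ 2 := by
    rw [dotProduct, Finset.mul_sum, ← Finset.sum_add_distrib]
    refine Finset.sum_le_sum fun x _ => ?_
    have : δ x = θhat x - θ₀ x := rfl
    rw [← this]
    nlinarith [sq_nonneg (Matrix.vecMul e S x - δ x / 2)]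
  have h5 := mul_le_mul_of_nonneg_left (ktv_sub_le k θhat θ₀) hlam
  rw [← hδ] at h5
  unfold ktfCriterion at h0
  linarith

theorem card_KTFRow_le (k d N : ℕ) : Fintype.card (KTFRow k d N) ≤ d * N ^ d := by
  rw [Fintype.card_sigma]
  calc _ ≤ ∑ _j : Fin d, N ^ d := Finset.sum_le_sum fun j _ => by
        have h1 : Fintype.card {i : Fin d // i ≠ j} = d - 1 := by
          rw [Fintype.card_subtype_compl]; simp
        have h2 : d = d - 1 + 1 := by have := j.2; omega
        rw [Fintype.card_prod, Fintype.card_fun, h1, Fintype.card_fin, Fintype.card_fin]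
        calc (N - (k + 1)) * N ^ (d - 1) ≤ N * N ^ (d - 1) :=
              Nat.mul_le_mul_right _ (Nat.sub_le _ _)
          _ = N ^ d := by rw [← pow_succ', ← h2]
    _ = _ := by simp

theorem tendsto_natCast_pow_atTop {d : ℕ} (hd : 1 ≤ d) :
    Tendsto (fun N : ℕ => (N : ℝ) ^ d) atTop atTop :=
  (tendsto_pow_atTop (by omega)).comp tendsto_natCast_atTop_atTop

/-- The rate `b` is attained as soon as there are scales `2 ^ J N` that fit into the lattice, are coarse
enough for the smoothing term (`hbias`), and are fine enough for `lam` to dominate the supremum of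
the noise seen through the multiscale kernel (`hnoise`). -/
theorem isBigOInProb_of_scale {k d : ℕ} (hd : 1 ≤ d) {K : ℝ} (hK : 0 < K)
    (hdec : HasMultiscaleDecomposition k d K) {σ : ℝ≥0} (hσ : 0 < σ)
    {Ω : ℕ → Type*} [∀ N, MeasurableSpace (Ω N)] {P : ∀ N, Measure (Ω N)}
    {θ₀ : ∀ N, LatticeIdx d N → ℝ} {y : ∀ N, Ω N → LatticeIdx d N → ℝ}
    {lam : ℕ → ℝ} {θhat : ∀ N, Ω N → LatticeIdx d N → ℝ}
    (hy : ∀ N, IsNormalMeansData (P N) σ (θ₀ N) (y N)) (hlam : ∀ N, 0 ≤ lam N)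
    (hθ : ∀ N ω, IsKTFEstimate k (lam N) (y N ω) (θhat N ω))
    {b : ℕ → ℝ} (J : ℕ → ℕ) {A A' : ℝ} (hA : 0 < A) (hA' : 0 < A')
    (hb : ∀ᶠ N in atTop, 0 < b N)
    (hJ : ∀ᶠ N in atTop, 2 * ((k + 1) * 2 ^ J N) ≤ N)
    (hbias : ∀ᶠ N in atTop, 1 ≤ A * b N * (2 ^ J N) ^ d)
    (hnoise : ∀ᶠ N : ℕ in atTop,
      4 * (σ ^ 2 * (K * (1 + ∑ j ∈ Finset.range (J N), scaleRatio k d ^ j)))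
        * Real.log ((N : ℝ) ^ d) ≤ lam N ^ 2)
    (hpen : ∀ᶠ N : ℕ in atTop, lam N * ktv k (θ₀ N) ≤ A' * (b N * (N : ℝ) ^ d)) :
    IsBigOInProb P (fun N ω => 1 / ((N : ℝ) ^ d) * ∑ x, (θhat N ω x - θ₀ N x) ^ 2) b := by
  intro ε hε
  have hσ' : (0 : ℝ) < σ := hσ
  set T : ℝ := 2 * (σ ^ 2 * K * A) / ε with hT
  have hTpos : 0 < T := by positivity
  refine ⟨4 * T + 8 * A', by positivity, ?_⟩
  have hn := (tendsto_natCast_pow_atTop hd).eventually_ge_atTop (2 * (2 * d) / ε)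
  filter_upwards [hb, hJ, hbias, hnoise, hpen, hn, eventually_ge_atTop 1] with
    N hb hJ hbias hnoise hpen hn hN
  have hN' : (0 : ℝ) < N := by exact_mod_cast hN
  set n : ℝ := (N : ℝ) ^ d with hnd
  have hn0 : 0 < n := by positivity
  obtain ⟨S, W, hSW, hW, hS⟩ := hdec N (J N) hJ
  set G := ∑ j ∈ Finset.range (J N), scaleRatio k d ^ j with hG
  have hG0 : 0 ≤ G := Finset.sum_nonneg fun j _ => by unfold scaleRatio; positivity
  have hV : 0 < K * (1 + G) := by positivity
  have hbad1 := (hy N).measure_exists_le_abs_sum_le (W := W) hσ hV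
    (fun r => (hW r).trans (by nlinarith)) (hlam N)
  have hbad2 := (hy N).measure_le_sum_sq_le S hS (T := T * (b N * n)) (by positivity)
  have hsub : {ω | (4 * T + 8 * A') * |b N|
      < |1 / n * ∑ x, (θhat N ω x - θ₀ N x) ^ 2|} ⊆
      {ω | ∃ r, lam N ≤ |Matrix.vecMul (fun x => y N ω x - θ₀ N x) W r|} ∪
      {ω | T * (b N * n) ≤ ∑ z, Matrix.vecMul (fun x => y N ω x - θ₀ N x) S z ^ 2} := by
    intro ω hω
    by_contra hcon
    rw [Set.mem_union, not_or] at hcon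
    obtain ⟨h1, h2⟩ := hcon
    have h1' : ∀ r, |Matrix.vecMul (fun x => y N ω x - θ₀ N x) W r| ≤ lam N := fun r =>
      le_of_not_ge fun h => h1 ⟨r, h⟩
    have h2' : ∑ z, Matrix.vecMul (fun x => y N ω x - θ₀ N x) S z ^ 2 < T * (b N * n) :=
      lt_of_not_ge fun h => h2 h
    have h3 := (hθ N ω).sum_sq_sub_le (hlam N) hSW h1'
    have hω' : (4 * T + 8 * A') * |b N| < |1 / n * ∑ x, (θhat N ω x - θ₀ N x) ^ 2| := hω
    rw [abs_of_pos hb, abs_of_nonneg (by positivity), one_div, ← div_eq_inv_mul,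
      lt_div_iff₀ hn0] at hω'
    nlinarith
  have hp1 : (Fintype.card (KTFRow k d N) : ℝ)
      * (2 * Real.exp (-(lam N ^ 2 / (2 * (σ ^ 2 * (K * (1 + G))))))) ≤ ε / 2 := by
    have hc : (Fintype.card (KTFRow k d N) : ℝ) ≤ d * n := by
      rw [hnd]; exact_mod_cast card_KTFRow_le k d N
    -- `hnoise` makes the Gaussian tail at least as small as `n ^ (-2)`
    have hexp : Real.exp (-(lam N ^ 2 / (2 * (σ ^ 2 * (K * (1 + G)))))) ≤ (n ^ 2)⁻¹ := by
      rw [← Real.exp_log hn0, ← Real.exp_nat_mul, ← Real.exp_neg]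
      refine Real.exp_le_exp.2 (neg_le_neg ?_)
      rw [le_div_iff₀ (by positivity)]
      push_cast
      linarith
    calc _ ≤ d * n * (2 * (n ^ 2)⁻¹) := by gcongr
      _ = 2 * d / n := by field_simp
      _ ≤ ε / 2 := by
        rw [div_le_iff₀ hε] at hn
        rw [div_le_iff₀ hn0]
        linarith
  have hp2 : σ ^ 2 * (K * ((N : ℝ) / 2 ^ J N) ^ d) / (T * (b N * n)) ≤ ε / 2 := by
    rw [div_le_iff₀ (by positivity), div_pow, ← hnd, hT]
    have : ε / 2 * (2 * (σ ^ 2 * K * A) / ε * (b N * n)) = σ ^ 2 * K * n * (A * b N) := by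
      field_simp
    rw [this]
    have h2 : n / (2 ^ J N) ^ d ≤ n * (A * b N) := by
      rw [div_le_iff₀ (by positivity)]
      nlinarith
    calc _ ≤ σ ^ 2 * (K * (n * (A * b N))) := by gcongr
      _ = _ := by ring
  calc _ ≤ _ := measure_mono hsub
    _ ≤ _ := measure_union_le _ _
    _ ≤ ENNReal.ofReal (ε / 2) + ENNReal.ofReal (ε / 2) :=
      add_le_add (hbad1.trans (ENNReal.ofReal_le_ofReal hp1))
        (hbad2.trans (ENNReal.ofReal_le_ofReal hp2))
    _ = ENNReal.ofReal ε := by rw [← ENNReal.ofReal_add (by positivity) (by positivity), add_halves]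

/-! ### Tuning parameter and rate -/

/-- The rate is `C / n` times the tuning parameter, at `C = n ^ (1 - s)`. -/
theorem ktfRate_eq {s n : ℝ} (hs : 0 < s) (hn : 0 < n) :
    ktfRate s n = n ^ (-s) * ktfTuning s n (n ^ (1 - s)) := by
  unfold ktfRate ktfTuning
  split_ifs
  · rfl
  · rfl
  · have h1 : n / n ^ (1 - s) = n ^ s := by
      rw [← Real.rpow_one_sub' hn.le (by simpa using hs.ne')]
      congr 1; ring
    rw [h1, ← Real.rpow_mul hn.le, mul_left_comm, ← Real.rpow_add hn, mul_comm]
    congr 2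
    have : 2 * s + 1 ≠ 0 := by positivity
    field_simp
    ring

theorem ktfTuning_isTheta {s : ℝ} (hs : 0 < s) {n C : ℕ → ℝ} (hn : Tendsto n atTop atTop)
    (hC0 : ∀ N, 0 ≤ C N) (hC : C =Θ[atTop] fun N => n N ^ (1 - s)) :
    (fun N => ktfTuning s (n N) (C N))
      =Θ[atTop] fun N => ktfTuning s (n N) (n N ^ (1 - s)) := by
  unfold ktfTuning
  split_ifs with h1 h2
  · exact isTheta_refl _ _
  · exact isTheta_refl _ _
  · have hp : 0 ≤ (2 * s - 1) / (2 * s + 1) := by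
      have := not_lt.1 h1
      apply div_nonneg <;> linarith
    refine (isTheta_refl _ _).mul ?_
    have hd := (isTheta_refl n atTop).div hC
    have hpos1 : 0 ≤ᶠ[atTop] fun N => n N / C N := by
      filter_upwards [hn.eventually_ge_atTop 0] with N h using div_nonneg h (hC0 N)
    have hpos2 : 0 ≤ᶠ[atTop] fun N => n N / n N ^ (1 - s) := by
      filter_upwards [hn.eventually_ge_atTop 0] with N h using div_nonneg h (Real.rpow_nonneg h _)
    exact ⟨hd.1.rpow hp hpos2, hd.2.rpow hp hpos1⟩

theorem ktfTuning_nonneg (s : ℝ) {n C : ℝ} (hn : 1 ≤ n) (hC : 0 ≤ C) : 0 ≤ ktfTuning s n C := by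
  have := Real.log_nonneg hn
  unfold ktfTuning
  split_ifs <;> positivity

theorem ktv_nonneg (k : ℕ) {d N : ℕ} (θ : LatticeIdx d N → ℝ) : 0 ≤ ktv k θ :=
  Finset.sum_nonneg fun _ _ => abs_nonneg _

theorem eventually_penalty_le {s : ℝ} (hs : 0 < s) {n C lam : ℕ → ℝ}
    (hn : Tendsto n atTop atTop) (hC : C =Θ[atTop] fun N => n N ^ (1 - s))
    (hlam : lam =Θ[atTop] fun N => ktfTuning s (n N) (n N ^ (1 - s))) :
    ∃ A : ℝ, 0 < A ∧ ∀ᶠ N in atTop, lam N * C N ≤ A * (ktfRate s (n N) * n N) := by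
  obtain ⟨A, hA, h⟩ := (hlam.1.mul hC.1).exists_pos
  refine ⟨A, hA, ?_⟩
  filter_upwards [h.bound, hn.eventually_ge_atTop 1] with N h hn1
  have hn0 : 0 < n N := by linarith
  have h0 := ktfTuning_nonneg s hn1 (Real.rpow_nonneg hn0.le (1 - s))
  refine (le_abs_self _).trans (h.trans (le_of_eq ?_))
  rw [Real.norm_of_nonneg (by positivity), ktfRate_eq hs hn0, sub_eq_neg_add, Real.rpow_add hn0,
    Real.rpow_one]
  ring

theorem ktfRate_pos {s n : ℝ} (hn : 1 < n) : 0 < ktfRate s n := by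
  have := Real.log_pos hn
  have : 0 < n := by linarith
  unfold ktfRate
  split_ifs <;> positivity

theorem effSmooth_pos {k d : ℕ} (hd : 1 ≤ d) : 0 < effSmooth k d := by
  unfold effSmooth; positivity

/-! ### Scales for the three regimes -/

theorem exists_dyadic {X : ℝ} (hX : 1 ≤ X) : ∃ J : ℕ, (2 : ℝ) ^ J ≤ X ∧ X < 2 * 2 ^ J := by
  obtain ⟨J, h1, h2⟩ := exists_nat_pow_near hX one_lt_two
  exact ⟨J, h1, by rwa [pow_succ'] at h2⟩

theorem effSmooth_mul {k d : ℕ} (hd : 1 ≤ d) : effSmooth k d * d = k + 1 := by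
  unfold effSmooth
  field_simp

theorem effSmooth_lt_half_iff {k d : ℕ} (hd : 1 ≤ d) : effSmooth k d < 1 / 2 ↔ 2 * (k + 1) < d := by
  unfold effSmooth
  rw [div_lt_div_iff₀ (by positivity) two_pos]
  constructor
  · intro h
    have : ((k + 1) * 2 : ℝ) < d := by linarith
    have : (k + 1) * 2 < d := by exact_mod_cast this
    omega
  · intro h
    have : ((2 * (k + 1) : ℕ) : ℝ) < d := by exact_mod_cast h
    push_cast at this
    linarith

theorem effSmooth_eq_half_iff {k d : ℕ} (hd : 1 ≤ d) : effSmooth k d = 1 / 2 ↔ 2 * (k + 1) = d := by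
  unfold effSmooth
  rw [div_eq_div_iff (by positivity) two_ne_zero]
  constructor
  · intro h
    have : ((k + 1) * 2 : ℝ) = d := by linarith
    have : (k + 1) * 2 = d := by exact_mod_cast this
    omega
  · intro h
    have : ((2 * (k + 1) : ℕ) : ℝ) = d := by exact_mod_cast h
    push_cast at this
    linarith

theorem one_add_scaleSum_le_of_lt_half {k d : ℕ} (hd : 1 ≤ d) (hs : effSmooth k d < 1 / 2) (J : ℕ) :
    1 + ∑ j ∈ Finset.range J, scaleRatio k d ^ j ≤ 1 + |1 / (1 - scaleRatio k d)| := by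
  have h1 : scaleRatio k d < 1 := by
    rw [scaleRatio, div_lt_one (by positivity)]
    exact pow_lt_pow_right₀ one_lt_two ((effSmooth_lt_half_iff hd).1 hs)
  have h0 : 0 ≤ scaleRatio k d := by unfold scaleRatio; positivity
  have h2 : ∑ j ∈ Finset.range J, scaleRatio k d ^ j ≤ 1 / (1 - scaleRatio k d) := by
    rw [geom_sum_eq h1.ne, ← neg_div_neg_eq, neg_sub, neg_sub]
    have : 0 < 1 - scaleRatio k d := by linarith
    gcongr
    have := pow_nonneg h0 J
    linarith
  linarith [le_abs_self (1 / (1 - scaleRatio k d))]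

theorem one_add_scaleSum_of_eq_half {k d : ℕ} (hd : 1 ≤ d) (hs : effSmooth k d = 1 / 2) (J : ℕ) :
    1 + ∑ j ∈ Finset.range J, scaleRatio k d ^ j = 1 + J := by
  have h1 : scaleRatio k d = 1 := by
    rw [scaleRatio, (effSmooth_eq_half_iff hd).1 hs, div_self (by positivity)]
  simp [h1]

theorem one_lt_scaleRatio {k d : ℕ} (hd : 1 ≤ d) (hs : 1 / 2 < effSmooth k d) :
    1 < scaleRatio k d := by
  have h1 := mt (effSmooth_lt_half_iff hd).2 (not_lt.2 hs.le)
  have h2 := mt (effSmooth_eq_half_iff hd).2 hs.ne'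
  rw [scaleRatio, one_lt_div (by positivity)]
  exact pow_lt_pow_right₀ one_lt_two (by omega)

theorem scaleRatio_pow {k d : ℕ} (hd : 1 ≤ d) (J : ℕ) :
    scaleRatio k d ^ J = (((2 : ℝ) ^ J) ^ d) ^ (2 * effSmooth k d - 1) := by
  have h := effSmooth_mul (k := k) hd
  have hL : (0 : ℝ) < 2 ^ J := by positivity
  have e : (d : ℝ) * (2 * effSmooth k d - 1) = ((2 * (k + 1) : ℕ) : ℝ) - d := by
    push_cast
    linear_combination 2 * h
  rw [← Real.rpow_natCast (2 ^ J) d, ← Real.rpow_mul hL.le, e, Real.rpow_sub hL, Real.rpow_natCast,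
    Real.rpow_natCast, scaleRatio, div_pow, ← pow_mul, ← pow_mul, ← pow_mul, ← pow_mul,
    mul_comm J, mul_comm J]

theorem one_add_scaleSum_le_of_half_lt {k d : ℕ} (hd : 1 ≤ d) (hs : 1 / 2 < effSmooth k d) (J : ℕ) :
    1 + ∑ j ∈ Finset.range J, scaleRatio k d ^ j
      ≤ (1 + 1 / (scaleRatio k d - 1)) * (((2 : ℝ) ^ J) ^ d) ^ (2 * effSmooth k d - 1) := by
  have h1 := one_lt_scaleRatio hd hs
  have h2 : 0 < scaleRatio k d - 1 := by linarith
  rw [← scaleRatio_pow hd, geom_sum_eq h1.ne', add_mul, one_mul, one_div_mul_eq_div]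
  have := one_le_pow₀ h1.le (n := J)
  gcongr
  linarith

/-- For `s ≤ 1 / 2` the coarsest scale, proportional to `N`, is taken; the noise then is of the order
of the tuning parameter. The factor `|1 / (1 - scaleRatio k d)|` is the geometric series for
`s < 1 / 2`, and takes the junk value `0` at `s = 1 / 2`, where the series is `J ≤ 2 log n`. -/
theorem exists_scale_of_le_half {k d : ℕ} (hd : 1 ≤ d) (hs : effSmooth k d ≤ 1 / 2) :
    ∃ (J : ℕ → ℕ) (A : ℝ), 0 < A ∧
      (∀ᶠ N in atTop, 2 * ((k + 1) * 2 ^ J N) ≤ N) ∧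
      (∀ᶠ N : ℕ in atTop, 1 ≤ A * ktfRate (effSmooth k d) ((N : ℝ) ^ d) * (2 ^ J N) ^ d) ∧
      ∀ᶠ N : ℕ in atTop, (1 + ∑ j ∈ Finset.range (J N), scaleRatio k d ^ j)
          * Real.log ((N : ℝ) ^ d)
        ≤ 3 * (1 + |1 / (1 - scaleRatio k d)|)
          * ktfTuning (effSmooth k d) ((N : ℝ) ^ d) (((N : ℝ) ^ d) ^ (1 - effSmooth k d)) ^ 2 := by
  have hk : (0 : ℝ) < 2 * (k + 1) := by positivity
  have hex : ∀ N : ℕ, ∃ J : ℕ, 2 * (k + 1) ≤ N →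
      (2 : ℝ) ^ J ≤ N / (2 * (k + 1)) ∧ (N : ℝ) / (2 * (k + 1)) < 2 * 2 ^ J := fun N => by
    by_cases h : 2 * (k + 1) ≤ N
    · have h' : ((2 * (k + 1) : ℕ) : ℝ) ≤ N := by exact_mod_cast h
      push_cast at h'
      obtain ⟨J, hJ⟩ := exists_dyadic (X := (N : ℝ) / (2 * (k + 1))) (by rwa [one_le_div hk])
      exact ⟨J, fun _ => hJ⟩
    · exact ⟨0, fun h' => absurd h' h⟩
  choose J hJ using hex
  have hn := tendsto_natCast_pow_atTop hd
  have hlog := (Real.tendsto_log_atTop.comp hn).eventually_ge_atTop 1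
  refine ⟨J, (4 * (k + 1)) ^ d, by positivity, ?_, ?_, ?_⟩
  · filter_upwards [eventually_ge_atTop (2 * (k + 1))] with N hN
    have h := (hJ N hN).1
    rw [le_div_iff₀ hk] at h
    have h' : ((2 * ((k + 1) * 2 ^ J N) : ℕ) : ℝ) ≤ N := by
      push_cast
      linarith
    exact_mod_cast h'
  · filter_upwards [eventually_ge_atTop (2 * (k + 1)), hlog] with N hN hlog
    have hN' : (0 : ℝ) < N := by
      have : 0 < N := by omega
      exact_mod_cast this
    have h := (hJ N hN).2
    rw [div_lt_iff₀ hk] at h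
    change 1 ≤ Real.log ((N : ℝ) ^ d) at hlog
    have h1 : (N : ℝ) ^ d ≤ (4 * (k + 1)) ^ d * (2 ^ J N) ^ d := by
      rw [← mul_pow]
      exact pow_le_pow_left₀ hN'.le (by linarith) d
    set n : ℝ := (N : ℝ) ^ d with hnd
    have hn0 : 0 < n := by positivity
    have hn1 : 1 ≤ n := by
      by_contra hcon
      have := Real.log_nonpos hn0.le (not_le.1 hcon).le
      linarith
    have h2 : n⁻¹ ≤ ktfRate (effSmooth k d) n := by
      have h3 : n⁻¹ ≤ n ^ (-effSmooth k d) := by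
        rw [← Real.rpow_neg_one]
        exact Real.rpow_le_rpow_of_exponent_le hn1 (by linarith)
      have h4 : 1 ≤ √(Real.log n) := Real.one_le_sqrt.2 hlog
      unfold ktfRate
      split_ifs with h5 h6
      · exact h3.trans (le_mul_of_one_le_right (by positivity) h4)
      · exact h3.trans (le_mul_of_one_le_right (by positivity) hlog)
      · exact absurd (lt_of_le_of_ne hs h6) h5
    have h3 : 0 ≤ ktfRate (effSmooth k d) n := (inv_nonneg.2 hn0.le).trans h2
    calc (1 : ℝ) = n⁻¹ * n := by field_simp
      _ ≤ ktfRate (effSmooth k d) n * ((4 * (k + 1)) ^ d * (2 ^ J N) ^ d) := by gcongr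
      _ = _ := by ring
  · filter_upwards [eventually_ge_atTop (2 * (k + 1)), hlog] with N hN hlog
    change 1 ≤ Real.log ((N : ℝ) ^ d) at hlog
    have habs := abs_nonneg (1 / (1 - scaleRatio k d))
    rcases lt_or_eq_of_le hs with h | h
    · rw [ktfTuning, if_pos h, Real.sq_sqrt (by linarith)]
      refine mul_le_mul_of_nonneg_right ?_ (by linarith)
      linarith [one_add_scaleSum_le_of_lt_half hd h (J N)]
    · rw [ktfTuning, if_neg h.not_lt, if_pos h, one_add_scaleSum_of_eq_half hd h, sq, ← mul_assoc]
      refine mul_le_mul_of_nonneg_right ?_ (by linarith)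
      have hN' : (1 : ℝ) ≤ N := by
        have : 1 ≤ N := by omega
        exact_mod_cast this
      have h1 := (hJ N hN).1
      have h2 : (2 : ℝ) ^ J N ≤ (N : ℝ) ^ d := by
        refine h1.trans ((div_le_self (by linarith) ?_).trans (le_self_pow₀ hN' (by omega)))
        have : (0 : ℝ) ≤ k := by positivity
        linarith
      have h3 := Real.log_le_log (by positivity) h2
      rw [Real.log_pow] at h3
      have h4 := Real.log_two_gt_d9
      have h5 : (J N : ℝ) ≤ 2 * Real.log ((N : ℝ) ^ d) := by
        have : (0 : ℝ) ≤ J N := by positivity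
        nlinarith
      nlinarith

theorem ktfRate_of_half_lt {s n : ℝ} (hs : 1 / 2 < s) :
    ktfRate s n = n ^ (-(2 * s / (2 * s + 1))) * Real.log n ^ (1 / (2 * s + 1)) := by
  rw [ktfRate, if_neg hs.not_gt, if_neg hs.ne']

/-- The balance that defines the scale for `s > 1 / 2`: blocks of `1 / ktfRate s n` points make the
noise level equal to the tuning parameter. -/
theorem inv_ktfRate_rpow_mul_log {s n : ℝ} (hs : 1 / 2 < s) (hn : 1 < n) :
    (1 / ktfRate s n) ^ (2 * s - 1) * Real.log n = ktfTuning s n (n ^ (1 - s)) ^ 2 := by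
  have hlog := Real.log_pos hn
  have hn0 : 0 < n := by linarith
  have hs1 : 2 * s + 1 ≠ 0 := by linarith
  have h1 : n / n ^ (1 - s) = n ^ s := by
    rw [← Real.rpow_one_sub' hn0.le (by rw [sub_sub_cancel]; linarith)]
    congr 1; ring
  rw [ktfRate_of_half_lt hs, ktfTuning, if_neg hs.not_gt, if_neg hs.ne', h1]
  have hx : 0 < n ^ (-(2 * s / (2 * s + 1))) * Real.log n ^ (1 / (2 * s + 1))  := by positivity
  refine Real.log_injOn_pos (Set.mem_Ioi.2 (by positivity)) (Set.mem_Ioi.2 (by positivity)) ?_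
  rw [Real.log_mul (by positivity) hlog.ne', Real.log_rpow (by positivity), one_div, Real.log_inv,
    Real.log_mul (by positivity) (by positivity), Real.log_rpow hn0, Real.log_rpow hlog,
    Real.log_pow, Real.log_mul (by positivity) (by positivity), Real.log_rpow hlog,
    Real.log_rpow (by positivity), Real.log_rpow hn0]
  push_cast
  field_simp
  ring

theorem tendsto_ktfRate_zero {s : ℝ} (hs : 1 / 2 < s) :
    Tendsto (fun n => ktfRate s n) atTop (nhds 0) := by
  have h1 : 0 < 1 / (2 * s + 1) := by apply one_div_pos.2; linarith
  have h2 := (isLittleO_log_rpow_atTop (r := 2 * s) (by linarith)).tendsto_div_nhds_zero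
  have h3 := h2.rpow_const (p := 1 / (2 * s + 1)) (Or.inr h1.le)
  rw [Real.zero_rpow h1.ne'] at h3
  refine h3.congr' ?_
  filter_upwards [eventually_ge_atTop 1] with n hn
  have hn0 : 0 < n := by linarith
  rw [ktfRate_of_half_lt hs, Real.div_rpow (Real.log_nonneg hn) (by positivity),
    ← Real.rpow_mul hn0.le, Real.rpow_neg hn0.le, mul_one_div, div_eq_inv_mul]

theorem tendsto_ktfRate_mul_atTop {s : ℝ} (hs : 1 / 2 < s) :
    Tendsto (fun n => ktfRate s n * n) atTop atTop := by
  have h1 : 0 < 1 / (2 * s + 1) := by apply one_div_pos.2; linarith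
  refine tendsto_atTop_mono' _ ?_ (tendsto_rpow_atTop h1)
  filter_upwards [eventually_ge_atTop 1,
    Real.tendsto_log_atTop.eventually_ge_atTop 1] with n hn hlog
  have hn0 : 0 < n := by linarith
  have h2 : ktfRate s n * n = n ^ (1 / (2 * s + 1)) * Real.log n ^ (1 / (2 * s + 1)) := by
    rw [ktfRate_of_half_lt hs, mul_right_comm, ← Real.rpow_add_one hn0.ne']
    congr 2
    have : 2 * s + 1 ≠ 0 := by linarith
    field_simp
    ring
  rw [h2]
  exact le_mul_of_one_le_right (by positivity) (Real.one_le_rpow hlog h1.le)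

/-- For `s > 1 / 2` blocks of about `η / ktfRate s n` points are taken. A small `η` brings the noise
level below any given multiple `κ` of the tuning parameter, so its implied constant is
arbitrary. -/
theorem exists_scale_of_half_lt {k d : ℕ} (hd : 1 ≤ d) (hs : 1 / 2 < effSmooth k d) {κ : ℝ}
    (hκ : 0 < κ) :
    ∃ (J : ℕ → ℕ) (A : ℝ), 0 < A ∧
      (∀ᶠ N in atTop, 2 * ((k + 1) * 2 ^ J N) ≤ N) ∧
      (∀ᶠ N : ℕ in atTop, 1 ≤ A * ktfRate (effSmooth k d) ((N : ℝ) ^ d) * (2 ^ J N) ^ d) ∧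
      ∀ᶠ N : ℕ in atTop, (1 + ∑ j ∈ Finset.range (J N), scaleRatio k d ^ j)
          * Real.log ((N : ℝ) ^ d)
        ≤ κ * ktfTuning (effSmooth k d) ((N : ℝ) ^ d)
            (((N : ℝ) ^ d) ^ (1 - effSmooth k d)) ^ 2 := by
  have hρ := one_lt_scaleRatio hd hs
  have hn := tendsto_natCast_pow_atTop hd
  set s := effSmooth k d with hsd
  have hs1 : 0 < 2 * s - 1 := by linarith
  set g : ℝ := 1 + 1 / (scaleRatio k d - 1) with hg
  have hg0 : 0 < g := by
    have : 0 < scaleRatio k d - 1 := by linarith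
    positivity
  set η : ℝ := (κ / g) ^ (1 / (2 * s - 1)) with hη
  have hη0 : 0 < η := by positivity
  have hηp : η ^ (2 * s - 1) = κ / g := by
    rw [hη, ← Real.rpow_mul (by positivity), one_div_mul_cancel hs1.ne', Real.rpow_one]
  set b : ℕ → ℝ := fun N => ktfRate s ((N : ℝ) ^ d) with hb
  have hd0 : (0 : ℝ) < d := by exact_mod_cast hd
  have hex : ∀ N : ℕ, ∃ J : ℕ, 0 < b N → b N ≤ η →
      ((2 : ℝ) ^ J) ^ d ≤ η / b N ∧ η / b N < 2 ^ d * (2 ^ J) ^ d := fun N => by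
    by_cases h : 0 < b N ∧ b N ≤ η
    · have h1 : 1 ≤ η / b N := (one_le_div h.1).2 h.2
      obtain ⟨J, hJ1, hJ2⟩ := exists_dyadic (Real.one_le_rpow h1 (one_div_nonneg.2 hd0.le))
      have h2 : ((η / b N) ^ (1 / (d : ℝ))) ^ d = η / b N := by
        rw [one_div, Real.rpow_inv_natCast_pow (by linarith) (by omega)]
      refine ⟨J, fun _ _ => ⟨?_, ?_⟩⟩
      · rw [← h2]
        exact pow_le_pow_left₀ (by positivity) hJ1 d
      · rw [← h2, ← mul_pow]
        exact pow_lt_pow_left₀ hJ2 (by positivity) (by omega)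
    · exact ⟨0, fun h1 h2 => absurd ⟨h1, h2⟩ h⟩
  choose J hJ using hex
  have hbpos : ∀ᶠ N in atTop, 0 < b N := by
    filter_upwards [hn.eventually_gt_atTop 1] with N hN using ktfRate_pos hN
  have hble : ∀ᶠ N in atTop, b N ≤ η :=
    ((tendsto_ktfRate_zero hs).comp hn).eventually_le_const hη0
  refine ⟨J, 2 ^ d / η, by positivity, ?_, ?_, ?_⟩
  · filter_upwards [hbpos, hble, ((tendsto_ktfRate_mul_atTop hs).comp hn).eventually_ge_atTop
      ((2 * (k + 1)) ^ d * η)] with N h0 h1 h2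
    change (2 * (k + 1)) ^ d * η ≤ b N * (N : ℝ) ^ d at h2
    have h3 := (hJ N h0 h1).1
    rw [le_div_iff₀ h0] at h3
    have h4 : (2 * (k + 1) * (2 : ℝ) ^ J N) ^ d ≤ (N : ℝ) ^ d := by
      rw [mul_pow (2 * (k + 1 : ℝ))]
      refine le_of_mul_le_mul_right ?_ h0
      calc _ = (2 * (k + 1 : ℝ)) ^ d * ((2 ^ J N) ^ d * b N) := by ring
        _ ≤ (2 * (k + 1 : ℝ)) ^ d * η := by gcongr
        _ ≤ _ := by rwa [mul_comm _ (b N)]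
    have h5 := le_of_pow_le_pow_left₀ (by omega) (by positivity) h4
    have h6 : ((2 * ((k + 1) * 2 ^ J N) : ℕ) : ℝ) ≤ N := by
      push_cast
      linarith
    exact_mod_cast h6
  · filter_upwards [hbpos, hble] with N h0 h1
    have h3 := (hJ N h0 h1).2.le
    rw [div_le_iff₀ h0] at h3
    change 1 ≤ 2 ^ d / η * b N * (2 ^ J N) ^ d
    rw [div_mul_eq_mul_div, div_mul_eq_mul_div, one_le_div hη0]
    linarith
  · filter_upwards [hbpos, hble, hn.eventually_gt_atTop 1] with N h0 h1 hN
    have hlog := Real.log_pos hN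
    rw [← inv_ktfRate_rpow_mul_log hs hN, ← mul_assoc]
    refine mul_le_mul_of_nonneg_right ?_ hlog.le
    refine (one_add_scaleSum_le_of_half_lt hd hs (J N)).trans ?_
    calc g * ((2 ^ J N) ^ d) ^ (2 * s - 1) ≤ g * (η / b N) ^ (2 * s - 1) := by
          gcongr
          exact (hJ N h0 h1).1
      _ = κ * (1 / b N) ^ (2 * s - 1) := by
          rw [div_eq_mul_one_div η, Real.mul_rpow hη0.le (by positivity), hηp]
          field_simp

end

theorem corollary1 (k d : ℕ) (hd : 1 ≤ d) (σ : ℝ≥0) (hσ : 0 < σ) :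
    -- a constant that depends on `k`, `d` and `σ` only
    ∃ c₀ : ℝ, 0 < c₀ ∧
      ∀ (Ω : ℕ → Type*) [∀ N, MeasurableSpace (Ω N)] (P : ∀ N, Measure (Ω N))
        [∀ N, IsProbabilityMeasure (P N)]
        (θ₀ : ∀ N, LatticeIdx d N → ℝ) (y : ∀ N, Ω N → LatticeIdx d N → ℝ)
        (lam : ℕ → ℝ) (θhat : ∀ N, Ω N → LatticeIdx d N → ℝ),
        (∀ N, IsNormalMeansData (P N) σ (θ₀ N) (y N)) →
        -- the canonical scaling `C_n ≍ n^(1-s)`, with `n = N^d`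
        ((fun N => ktv k (θ₀ N)) =Θ[atTop]
          fun N => ((N : ℝ) ^ d) ^ (1 - effSmooth k d)) →
        -- the choice of the tuning parameter
        (∀ N, 0 ≤ lam N) →
        (lam =Θ[atTop] fun N => ktfTuning (effSmooth k d) ((N : ℝ) ^ d) (ktv k (θ₀ N))) →
        -- for `s ≤ 1/2`, the implied lower constant in the choice of `lam` is large enough
        (effSmooth k d ≤ 1 / 2 →
          ∀ᶠ N : ℕ in atTop,
            c₀ * ktfTuning (effSmooth k d) ((N : ℝ) ^ d) (ktv k (θ₀ N)) ≤ lam N) →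
        (∀ N ω, IsKTFEstimate k (lam N) (y N ω) (θhat N ω)) →
        IsBigOInProb P
          (fun N ω => 1 / ((N : ℝ) ^ d) * ∑ x, (θhat N ω x - θ₀ N x) ^ 2)
          (fun N => ktfRate (effSmooth k d) ((N : ℝ) ^ d)) := by
  obtain ⟨K, hK, hdec⟩ := exists_hasMultiscaleDecomposition k d hd
  have hσ' : (0 : ℝ) < σ := hσ
  have hs0 : 0 < effSmooth k d := effSmooth_pos hd
  have hn := tendsto_natCast_pow_atTop hd
  set Q : ℝ := 4 * (σ ^ 2 * K) with hQ
  have hQ0 : 0 < Q := by positivity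
  set H : ℝ := 3 * (1 + |1 / (1 - scaleRatio k d)|) with hH
  have hH0 : 0 < H := by positivity
  -- `c₀ ^ 2 = Q * H` compares the noise level with the tuning parameter for `s ≤ 1 / 2`
  refine ⟨√(Q * H), by positivity, ?_⟩
  intro Ω _ P _ θ₀ y lam θhat hy hC hlam0 hlam hc₀ hθ
  have hlam' := hlam.trans (ktfTuning_isTheta hs0 hn (fun N => ktv_nonneg k (θ₀ N)) hC)
  obtain ⟨A', hA', hpen⟩ := eventually_penalty_le hs0 hn hC hlam'
  have hb : ∀ᶠ N : ℕ in atTop, 0 < ktfRate (effSmooth k d) ((N : ℝ) ^ d) := by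
    filter_upwards [hn.eventually_gt_atTop 1] with N hN using ktfRate_pos hN
  rcases le_or_gt (effSmooth k d) (1 / 2) with hs | hs
  · obtain ⟨J, A, hA, hJ, hbias, hnoise⟩ := exists_scale_of_le_half hd hs
    refine isBigOInProb_of_scale hd hK hdec hσ hy hlam0 hθ J hA hA' hb hJ hbias ?_ hpen
    filter_upwards [hnoise, hc₀ hs, hn.eventually_ge_atTop 1] with N h1 h2 hN
    have h3 : ktfTuning (effSmooth k d) ((N : ℝ) ^ d) (ktv k (θ₀ N))
        = ktfTuning (effSmooth k d) ((N : ℝ) ^ d) (((N : ℝ) ^ d) ^ (1 - effSmooth k d)) := by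
      unfold ktfTuning
      split_ifs with h5 h6
      · rfl
      · rfl
      · exact absurd (lt_of_le_of_ne hs h6) h5
    rw [h3] at h2
    have h0 := ktfTuning_nonneg (effSmooth k d) hN
      (Real.rpow_nonneg (by linarith : (0 : ℝ) ≤ (N : ℝ) ^ d) (1 - effSmooth k d))
    have h4 := pow_le_pow_left₀ (by positivity) h2 2
    rw [mul_pow, Real.sq_sqrt (by positivity)] at h4
    refine le_trans (le_trans (le_of_eq ?_) (mul_le_mul_of_nonneg_left h1 hQ0.le))
      (le_trans (le_of_eq ?_) h4)
    · rw [hQ]; ring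
    · ring
  · obtain ⟨c, hc, h⟩ := hlam'.2.exists_pos
    obtain ⟨J, A, hA, hJ, hbias, hnoise⟩ :=
      exists_scale_of_half_lt hd hs (κ := 1 / (Q * c ^ 2)) (by positivity)
    refine isBigOInProb_of_scale hd hK hdec hσ hy hlam0 hθ J hA hA' hb hJ hbias ?_ hpen
    filter_upwards [hnoise, h.bound, hn.eventually_ge_atTop 1] with N h1 h2 hN
    have h0 := ktfTuning_nonneg (effSmooth k d) hN
      (Real.rpow_nonneg (by linarith : (0 : ℝ) ≤ (N : ℝ) ^ d) (1 - effSmooth k d))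
    rw [Real.norm_of_nonneg h0, Real.norm_of_nonneg (hlam0 N)] at h2
    have h4 := pow_le_pow_left₀ h0 h2 2
    refine le_trans (le_trans (le_of_eq ?_) (mul_le_mul_of_nonneg_left h1 hQ0.le)) ?_
    · rw [hQ]; ring
    · rw [← mul_assoc, mul_one_div, ← div_div, div_self hQ0.ne', one_div,
        inv_mul_le_iff₀ (by positivity)]
      rwa [mul_pow] at h4
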